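/- Let $N\ge 0$ and $-\infty=x_0<x_1<\dots<x_N<x_{N+1}=+\infty$, and let $h_1,h_2:\mathbb R\to\mathbb R$ be continuous and piecewise linear: there are constants $\kappa_i^j$ ($i=1,2$, $j=0,\dots,N$) such that $h_i'(x)=\kappa_i^j$ for $x\in\,]x_j,x_{j+1}[$. Assume that all the pairs $K^j=(\kappa_1^j,\kappa_2^j)$ lie in the open first quadrant, i.e. $\kappa_1^j>0$ and $\kappa_2^j>0$ for all $j$. Consider the system $$u_1=h_1-u_1'u_2'-\tfrac12(u_1')^2,\qquad u_2=h_2-u_1'u_2'-\tfrac12(u_2')^2\qquad\text{on }\mathbb R. \tag{HJ}$$ A function $u=(u_1,u_2):\mathbb R\to\mathbb R^2$ is called an *admissible solution* of (HJ) if - (A1) $u$ is (locally) absolutely continuous and (HJ) holds at almost every $x\in\mathbb R$; - (A2) there is a constant $C$ with $|u(x)|\le C(1+|x|)$ for all $x\in\mathbb R$; - (A3) at every $y\in\mathbb R$ the derivative $u'$ (considered at the points where it exists) has a right limit $u'(y+)$ and a left limit $u'(y-)$, and wherever these differ, $u_1'(y+)+u_2'(y+)\le 0$ or $u_1'(y-)+u_2'(y-)\ge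 0$. Then (HJ) has exactly one admissible solution $u$. Moreover $u$ is differentiable on $\mathbb R$ with bounded derivative, and the feedbacks $\alpha_i^*=-u_i'$ form a Nash equilibrium in feedback form of the following two-player game, for all compact control sets $A_1,A_2\subset\mathbb R$ with $\alpha_i^*(x)\in A_i$ for all $x\in\mathbb R$, $i=1,2$. The dynamics is $\dot x=\alpha_1+\alpha_2$, $x(0)=y$, and player $i$ chooses $\alpha_i$ with values in $A_i$ so as to minimize $$J_i=\int_0^\infty e^{-t}\Big[h_i(x(t))+\frac{\alpha_i(t)^2}{2}\Big]\,dt .$$ That is, for every $y\in\mathbb R$: - the Cauchy problem $\dot x=\alpha_1^*(x)+\alpha_2^*(x)$, $x(0)=y$, has at least one Carathéodory solution on $[0,\infty[$ (a locally absolutely continuous function satisfying the equation at a.e. $t>0$); - for every such solution $x(\cdot)$ and for $\{i,j\}=\{1,2\}$, the control $t\mapsto\alpha_i^*(x(t))$ with the trajectory $x(\cdot)$ minimizes $J_i$ among all pairs $(\beta,z)$ where $\beta:[0,\infty[\,\to A_i$ is measurable and $z$ is a Carathéodory solution of $\dot z=\beta(t)+\alpha_j^*(z)$, $z(0)=y$;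 the integrals $J_i$ of all these pairs converge absolutely. -/

import Mathlib

open Set Filter Topology MeasureTheory

noncomputable section

namespace ScalarGame

/-- The `j`-th open interval of the subdivision of the real line with breakpoints
`x 0 < x 1 < ... < x (N - 1)`; the first and the last interval are unbounded
(and the only interval is the whole line if `N = 0`). -/
def piece {N : ℕ} (x : Fin N → ℝ) (j : Fin (N + 1)) : Set ℝ :=
  {y | ∀ k : Fin N, (k.castSucc < j → x k < y) ∧ (j ≤ k.castSucc → y < x k)}

/-- Both costs `h i` are continuous and piecewise linear: on the `j`-th open interval of the
subdivision, `h i` has constant derivative `κ j i`. -/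
structure IsPiecewiseLinear {N : ℕ} (x : Fin N → ℝ) (κ : Fin (N + 1) → Fin 2 → ℝ)
    (h : Fin 2 → ℝ → ℝ) : Prop where
  breakpoints : StrictMono x
  continuous : ∀ i, Continuous (h i)
  slope : ∀ j, ∀ y ∈ piece x j, ∀ i, HasDerivAt (h i) (κ j i) y

/-- The points at which the derivative of both components of `u` exists. -/
def derivDomain (u : Fin 2 → ℝ → ℝ) : Set ℝ := {x | ∀ i, DifferentiableAt ℝ (u i) x}

/-- Admissible solutions of the stationary Hamilton-Jacobi system
`u_i = h_i - u_1' u_2' - (u_i')^2 / 2`, `i = 1, 2`. One-sided limits of `u'` are taken along the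
points at which `u'` exists. -/
structure IsAdmissible (h u : Fin 2 → ℝ → ℝ) : Prop where
  absolutelyContinuous : ∀ i a b, AbsolutelyContinuousOnInterval (u i) a b
  equation : ∀ᵐ x : ℝ, x ∈ derivDomain u ∧
    ∀ i, u i x = h i x - deriv (u 0) x * deriv (u 1) x - (deriv (u i) x) ^ 2 / 2
  growth : ∃ C : ℝ, ∀ i x, |u i x| ≤ C * (1 + |x|)
  jumps : ∀ y : ℝ, ∃ pr pl : Fin 2 → ℝ,
    (∀ i, Tendsto (deriv (u i)) (𝓝[Ioi y ∩ derivDomain u] y) (𝓝 (pr i))) ∧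
    (∀ i, Tendsto (deriv (u i)) (𝓝[Iio y ∩ derivDomain u] y) (𝓝 (pl i))) ∧
    (pr ≠ pl → pr 0 + pr 1 ≤ 0 ∨ 0 ≤ pl 0 + pl 1)

/-- `z` is a Caratheodory solution on `[0, ∞)` of `z'(t) = f t (z t)`, `z 0 = y`. -/
structure IsCaratheodorySol (f : ℝ → ℝ → ℝ) (y : ℝ) (z : ℝ → ℝ) : Prop where
  initial : z 0 = y
  absolutelyContinuous : ∀ T, 0 ≤ T → AbsolutelyContinuousOnInterval z 0 T
  equation : ∀ᵐ t ∂(volume.restrict (Ioi (0 : ℝ))), HasDerivAt z (f t (z t)) t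

/-- The discounted running cost of a player with cost function `g` who uses the control `β`
while the state follows `z`. -/
def costIntegrand (g z β : ℝ → ℝ) (t : ℝ) : ℝ := Real.exp (-t) * (g (z t) + β t ^ 2 / 2)

/-- The cost `∫_0^∞ e^{-t} (g(z(t)) + β(t)^2 / 2) dt`. -/
def cost (g z β : ℝ → ℝ) : ℝ := ∫ t in Ioi (0 : ℝ), costIntegrand g z β t

/-- `β` is a measurable control with values in `B`, and `z` is a corresponding trajectory from `y`,
when the opponent plays the feedback `γ`. -/
structure IsControlPair (B : Set ℝ) (γ : ℝ → ℝ) (y : ℝ) (β z : ℝ → ℝ) : Prop where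
  measurable : AEMeasurable β (volume.restrict (Ioi (0 : ℝ)))
  mem : ∀ᵐ t ∂(volume.restrict (Ioi (0 : ℝ))), β t ∈ B
  trajectory : IsCaratheodorySol (fun t x => β t + γ x) y z

/-- The pair `(β, z)` solves the optimal control problem of a player with control set `B` and cost
function `g`, from the initial state `y`, when the opponent plays the feedback `γ`. All the costs
that are compared are given by convergent integrals. -/
structure IsOptimalPair (B : Set ℝ) (g γ : ℝ → ℝ) (y : ℝ) (β z : ℝ → ℝ) : Prop where
  pair : IsControlPair B γ y β z
  finite : ∀ β' z', IsControlPair B γ y β' z' → IntegrableOn (costIntegrand g z' β') (Ioi 0)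
  minimal : ∀ β' z', IsControlPair B γ y β' z' → cost g z β ≤ cost g z' β'

/-- The feedbacks `α 0`, `α 1` form a Nash equilibrium of the game with dynamics
`x' = α_1 + α_2`, control sets `A i` and cost functions `h i`. -/
structure IsFeedbackNash (A : Fin 2 → Set ℝ) (h α : Fin 2 → ℝ → ℝ) : Prop where
  mem : ∀ i x, α i x ∈ A i
  exists_sol : ∀ y, ∃ z, IsCaratheodorySol (fun _ x => α 0 x + α 1 x) y z
  optimal : ∀ y z, IsCaratheodorySol (fun _ x => α 0 x + α 1 x) y z →
    ∀ i j, i ≠ j → IsOptimalPair (A i) (h i) (α j) y (fun t => α i (z t)) z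

end ScalarGame

end

noncomputable section

/-! ### One-sided derivative estimates and linear growth -/

namespace ScalarGame

/-! Put `v = h - u` and `p = u'`. The system reads `v = F p` with `F p = (p₀p₁ + p₀²/2, p₀p₁ +
p₁²/2)`, and `F` determines `p` up to sign. Hence a jump of `u'` is exactly a change of sign, and
(A3) allows it only from `p₀ + p₁ ≥ 0` to `p₀ + p₁ ≤ 0`.

Location of the gradient. If some component of `v` is negative, `p` lies in the open second or
fourth quadrant. The set `v ≥ 0` is invariant to the right, so leaving it once means being outside
on a whole left half-line. There `p` cannot stay in one quadrant, by linear growth, and the slopes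
of `h` are eventually constant; comparing `v 0 - v 1` at successive jumps then gives a contradiction
(`false_of_out_of_le`). So `v ≥ 0`, and `p` lies in the closed first or third quadrant. The third
would persist to the right and force superlinear growth, so `p` lies in the first
(`right_mem_quadrant`).

Uniqueness. On the first quadrant `F` is monotone: `(F p - F p')·(p - p') = s Q / 2`, with `s` the
sum of all four components and `Q` a positive definite quadratic form in `p - p'`. Thus `E = |v -
v'|²` satisfies `E' = -s Q` and `E ≤ 2 s² Q`. Since linear growth of `v` gives `s = O(√|x|)`, a
nonzero `E` would grow like the fourth power of `|x|` at `-∞`, while it is at most quadratic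
(`eq_of_right_mem_quadrant`).

Existence. On a square in the first quadrant `F` has a Lipschitz inverse `Φ`. The ODE `u' = Φ (h -
u)` is started from the equilibrium belonging to the leftmost slopes, and the square is invariant to
the right (`HasSlopes.exists_isClassicalSol`). By uniqueness every admissible solution is this C¹
one with Lipschitz gradient.

Nash property. Along any trajectory, running cost plus the derivative of `e^{-t} u i (z t)` equals
`e^{-t} (p i (z t) + β t)² / 2`, which is nonnegative and vanishes for the feedback `-p i`
(`tendsto_integral`). -/

theorem mul_sub_le_of_le_deriv_right {f f' : ℝ → ℝ} {m a b : ℝ} (hab : a ≤ b)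
    (hf : Continuous f) (hf' : ∀ x ∈ Ico a b, HasDerivWithinAt f (f' x) (Ici x) x)
    (hm : ∀ x ∈ Ico a b, m ≤ f' x) : m * (b - a) ≤ f b - f a := by
  have hB : ∀ x, HasDerivAt (fun x => f a + m * (x - a)) m x := fun x => by
    simpa using (((hasDerivAt_id x).sub_const a).const_mul m).const_add (f a)
  have := image_le_of_deriv_right_le_deriv_boundary (f := fun x => f a + m * (x - a))
    (f' := fun _ => m) (B := f) (B' := f') (a := a) (b := b)
    (fun x _ => (hB x).continuousAt.continuousWithinAt)
    (fun x _ => (hB x).hasDerivWithinAt) (by simp) hf.continuousOn hf' hm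
    (right_mem_Icc.2 hab)
  linarith

theorem sub_le_mul_of_deriv_right_le {f f' : ℝ → ℝ} {m a b : ℝ} (hab : a ≤ b)
    (hf : Continuous f) (hf' : ∀ x ∈ Ico a b, HasDerivWithinAt f (f' x) (Ici x) x)
    (hm : ∀ x ∈ Ico a b, f' x ≤ m) : f b - f a ≤ m * (b - a) := by
  have := mul_sub_le_of_le_deriv_right (f := fun x => -f x) (f' := fun x => -f' x) (m := -m) hab
    hf.neg (fun x hx => (hf' x hx).neg) (fun x hx => neg_le_neg (hm x hx))
  linarith

theorem eventually_lt_of_deriv_right_pos {f : ℝ → ℝ} {d y : ℝ}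
    (hf : HasDerivWithinAt f d (Ici y) y) (hd : 0 < d) : ∀ᶠ x in 𝓝[>] y, f y < f x := by
  have h := (hasDerivWithinAt_iff_tendsto_slope' (by simp)).1 (hf.mono Ioi_subset_Ici_self)
  filter_upwards [h.eventually (lt_mem_nhds hd), self_mem_nhdsWithin] with x hx hxy
  rw [slope_def_field] at hx
  have : 0 < x - y := sub_pos.2 hxy
  have := (div_pos_iff_of_pos_right this).1 hx
  linarith

theorem eventually_lt_of_deriv_left_pos {f : ℝ → ℝ} {d y : ℝ}
    (hf : HasDerivWithinAt f d (Iic y) y) (hd : 0 < d) : ∀ᶠ x in 𝓝[<] y, f x < f y := by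
  have h := (hasDerivWithinAt_iff_tendsto_slope' (by simp)).1 (hf.mono Iio_subset_Iic_self)
  filter_upwards [h.eventually (lt_mem_nhds hd), self_mem_nhdsWithin] with x hx hxy
  rw [slope_def_field] at hx
  have : x - y < 0 := sub_neg.2 hxy
  have := (div_pos_iff.1 hx)
  rcases this with h | h <;> linarith [h.1, h.2]

/-- A function that grows at most linearly cannot have arbitrarily large negative slopes
at `-∞`. -/
theorem false_of_deriv_right_le_atBot {f f' : ℝ → ℝ} {C : ℝ} (hf : Continuous f)
    (hC : ∀ x, |f x| ≤ C * (1 + |x|))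
    (h : ∀ M : ℝ, ∃ a, ∀ x < a, HasDerivWithinAt f (f' x) (Ici x) x ∧ f' x ≤ -M) : False := by
  obtain ⟨a, ha⟩ := h (C + 1)
  set b := min a 0 with hb
  have hb0 : b ≤ 0 := min_le_right _ _
  have hba : b ≤ a := min_le_left _ _
  have hC0 : 0 ≤ C := by have := (abs_nonneg _).trans (hC 0); simpa using this
  set y := b - (C + 2 * (C * (1 + |b|)) + 1) with hy
  have hnn : 0 ≤ C * (1 + |b|) := by positivity
  have hyb : y ≤ b := by linarith
  have h1 := sub_le_mul_of_deriv_right_le (m := -(C + 1)) hyb hf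
    (fun x hx => (ha x (hx.2.trans_le hba)).1) (fun x hx => (ha x (hx.2.trans_le hba)).2)
  have h2 := (abs_le.1 (hC y)).2
  have h3 := (abs_le.1 (hC b)).1
  rw [abs_of_nonpos (by linarith : y ≤ 0)] at h2
  have : b - y = C + 2 * (C * (1 + |b|)) + 1 := by rw [hy]; ring
  have h4 : C * |b| = -(C * b) := by rw [abs_of_nonpos hb0]; ring
  nlinarith

theorem false_of_le_deriv_right_atTop {f f' : ℝ → ℝ} {C : ℝ} (hf : Continuous f)
    (hC : ∀ x, |f x| ≤ C * (1 + |x|))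
    (h : ∀ M : ℝ, ∃ a, ∀ x ≥ a, HasDerivWithinAt f (f' x) (Ici x) x ∧ M ≤ f' x) : False := by
  obtain ⟨a, ha⟩ := h (C + 1)
  set b := max a 0 with hb
  have hb0 : 0 ≤ b := le_max_right _ _
  have hba : a ≤ b := le_max_left _ _
  have hC0 : 0 ≤ C := by have := (abs_nonneg _).trans (hC 0); simpa using this
  set y := b + (C + 2 * (C * (1 + |b|)) + 1) with hy
  have hnn : 0 ≤ C * (1 + |b|) := by positivity
  have hyb : b ≤ y := by linarith
  have h1 := mul_sub_le_of_le_deriv_right (m := (C + 1)) hyb hf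
    (fun x hx => (ha x (hba.trans hx.1)).1) (fun x hx => (ha x (hba.trans hx.1)).2)
  have h2 := (abs_le.1 (hC y)).2
  have h3 := (abs_le.1 (hC b)).1
  rw [abs_of_nonneg (by linarith : 0 ≤ y)] at h2
  have : y - b = C + 2 * (C * (1 + |b|)) + 1 := by rw [hy]; ring
  have h4 : C * |b| = C * b := by rw [abs_of_nonneg hb0]
  nlinarith

/-! ### The gradient of a regulated solution lies in the first quadrant -/

/-- The equation for `v = h - u` in terms of the one-sided limits `L`, `R` of the
derivative `u'`, where `l`, `r` are the one-sided derivatives of `h`. -/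
structure RegulatedSol (l r v L R : Fin 2 → ℝ → ℝ) : Prop where
  continuous : ∀ i, Continuous (v i)
  derivR : ∀ i y, HasDerivWithinAt (v i) (r i y - R i y) (Ici y) y
  derivL : ∀ i y, HasDerivWithinAt (v i) (l i y - L i y) (Iic y) y
  tendsto_RR : ∀ i y, Tendsto (R i) (𝓝[>] y) (𝓝 (R i y))
  tendsto_LR : ∀ i y, Tendsto (L i) (𝓝[>] y) (𝓝 (R i y))
  tendsto_LL : ∀ i y, Tendsto (L i) (𝓝[<] y) (𝓝 (L i y))
  tendsto_RL : ∀ i y, Tendsto (R i) (𝓝[<] y) (𝓝 (L i y))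
  eqR : ∀ i y, v i y = R 0 y * R 1 y + R i y ^ 2 / 2
  eqL : ∀ i y, v i y = L 0 y * L 1 y + L i y ^ 2 / 2
  jump : ∀ y, (∀ i, R i y = L i y) ∨ ((∀ i, R i y = -L i y) ∧ 0 ≤ L 0 y + L 1 y)
  growth : ∃ C, ∀ i y, |v i y| ≤ C * (1 + |y|)

namespace RegulatedSol

variable {l r v L R : Fin 2 → ℝ → ℝ}

theorem swap (S : RegulatedSol l r v L R) :
    RegulatedSol (fun i => l i.rev) (fun i => r i.rev) (fun i => v i.rev) (fun i => L i.rev)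
      (fun i => R i.rev) where
  continuous i := S.continuous _
  derivR i := S.derivR _
  derivL i := S.derivL _
  tendsto_RR i := S.tendsto_RR _
  tendsto_LR i := S.tendsto_LR _
  tendsto_LL i := S.tendsto_LL _
  tendsto_RL i := S.tendsto_RL _
  eqR i y := by rw [S.eqR]; exact congrArg (· + _) (mul_comm _ _)
  eqL i y := by rw [S.eqL]; exact congrArg (· + _) (mul_comm _ _)
  jump y := by
    rcases S.jump y with h | ⟨h, h'⟩
    · exact Or.inl fun i => h _
    · exact Or.inr ⟨fun i => h _, by rw [add_comm] at h'; exact h'⟩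
  growth := S.growth.imp fun C hC i y => hC _ y

/-- `u'` cannot stay in the fourth quadrant on a left half-line. -/
theorem not_fourth_quadrant (S : RegulatedSol l r v L R) {c K y₀ : ℝ} (hc : 0 < c)
    (hr : ∀ i, ∀ y < y₀, c ≤ r i y ∧ r i y ≤ K) (hR : ∀ y < y₀, 0 < R 0 y ∧ R 1 y < 0) :
    False := by
  obtain ⟨C, hC⟩ := S.growth
  refine false_of_deriv_right_le_atBot (f' := fun y => r 0 y - R 0 y) (S.continuous 0) (hC 0)
    fun M => ?_
  set m := max (M + K) 0 with hm
  refine ⟨y₀ - (|v 1 y₀| + m ^ 2 / 2 + 1) / c, fun y hy => ⟨S.derivR 0 y, ?_⟩⟩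
  have hpos : 0 < (|v 1 y₀| + m ^ 2 / 2 + 1) / c := by positivity
  have hyy : y < y₀ := by linarith
  have h1 := mul_sub_le_of_le_deriv_right (m := c) hyy.le (S.continuous 1)
    (fun x _ => S.derivR 1 x) (fun x hx => by linarith [(hr 1 x hx.2).1, (hR x hx.2).2])
  have h2 : |v 1 y₀| + m ^ 2 / 2 + 1 < c * (y₀ - y) := by
    rw [← div_lt_iff₀' hc]; linarith
  have h3 := le_abs_self (v 1 y₀)
  have h4 := S.eqR 1 y
  -- Since `(R 0 + R 1)² ≥ 0`, the equation gives `v 1 ≥ -(R 0)² / 2`. As `v 1` has slope at least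
  -- `c`, it tends to `-∞` on the left, so `R 0` is unbounded there and the slope of `v 0` tends to
  -- `-∞`.
  have h5 : m ^ 2 < R 0 y ^ 2 := by nlinarith [sq_nonneg (R 0 y + R 1 y)]
  have h6 : m < R 0 y := lt_of_pow_lt_pow_left₀ 2 (hR y hyy).1.le h5
  have := le_max_left (M + K) 0
  linarith [(hr 0 y hyy).2]

theorem not_second_quadrant (S : RegulatedSol l r v L R) {c K y₀ : ℝ} (hc : 0 < c)
    (hr : ∀ i, ∀ y < y₀, c ≤ r i y ∧ r i y ≤ K) (hR : ∀ y < y₀, R 0 y < 0 ∧ 0 < R 1 y) :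
    False :=
  S.swap.not_fourth_quadrant hc (fun _ => hr _) fun y hy => (hR y hy).symm

theorem mul_neg_of_out {p q : ℝ} (h : p * q + p ^ 2 / 2 < 0 ∨ p * q + q ^ 2 / 2 < 0) :
    p * q < 0 := by
  rcases h with h | h <;> nlinarith [sq_nonneg p, sq_nonneg q]

/-- If `h - u` leaves the first quadrant on a left half-line, then `u'` has a jump from the second
to the fourth quadrant. -/
theorem exists_jump (S : RegulatedSol l r v L R) {c K y₀ : ℝ} (hc : 0 < c)
    (hr : ∀ i, ∀ y < y₀, c ≤ r i y ∧ r i y ≤ K) (hout : ∀ y ≤ y₀, v 0 y < 0 ∨ v 1 y < 0) :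
    ∃ d < y₀, L 0 d < 0 ∧ 0 < R 0 d := by
  have hR : ∀ y ≤ y₀, R 0 y * R 1 y < 0 := fun y hy => by
    have := hout y hy
    rw [S.eqR 0, S.eqR 1] at this
    exact mul_neg_of_out this
  have hL : ∀ y ≤ y₀, L 0 y * L 1 y < 0 := fun y hy => by
    have := hout y hy
    rw [S.eqL 0, S.eqL 1] at this
    exact mul_neg_of_out this
  obtain ⟨b, hb, hb'⟩ : ∃ b < y₀, 0 < R 0 b := by
    by_contra! hcon
    refine S.not_second_quadrant hc hr fun y hy => ?_
    rcases mul_neg_iff.1 (hR y hy.le) with h | h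
    · exact absurd h.1 (not_lt.2 (hcon y hy))
    · exact h
  obtain ⟨a, hab, ha'⟩ : ∃ a < b, R 0 a < 0 := by
    by_contra! hcon
    refine S.not_fourth_quadrant (y₀ := b) hc (fun i y hy => hr i y (hy.trans hb)) fun y hy => ?_
    rcases mul_neg_iff.1 (hR y (hy.trans hb).le) with h | h
    · exact h
    · exact absurd h.1 (not_lt.2 (hcon y hy))
  set T := {x | x ∈ Icc a b ∧ R 0 x < 0} with hT
  have hTne : T.Nonempty := ⟨a, ⟨le_rfl, hab.le⟩, ha'⟩
  have hTb : BddAbove T := ⟨b, fun x hx => hx.1.2⟩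
  -- The last passage from `R 0 < 0` to `R 0 > 0` must be a jump, because `R 0 * R 1 < 0` keeps `R
  -- 0` and its limits away from zero.
  set d := sSup T with hd
  have hdb : d ≤ b := csSup_le hTne fun x hx => hx.1.2
  have had : a ≤ d := le_csSup hTb ⟨⟨le_rfl, hab.le⟩, ha'⟩
  have hRd : 0 < R 0 d := by
    rcases hdb.eq_or_lt with h | h
    · rwa [h]
    · have h1 : 0 ≤ R 0 d := by
        refine ge_of_tendsto (S.tendsto_RR 0 d) ?_
        filter_upwards [Ioo_mem_nhdsGT h] with x hx
        by_contra! hx'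
        exact absurd (le_csSup hTb ⟨⟨had.trans hx.1.le, hx.2.le⟩, hx'⟩) (not_le.2 hx.1)
      rcases h1.eq_or_lt with h1 | h1
      · have := hR d (hdb.trans hb.le)
        rw [← h1, zero_mul] at this
        exact absurd this (lt_irrefl _)
      · exact h1
  refine ⟨d, hdb.trans_lt hb, ?_, hRd⟩
  have hdT : d ∉ T := fun h => absurd h.2 (not_lt.2 hRd.le)
  rcases mul_neg_iff.1 (hL d (hdb.trans hb.le)) with h | h
  · exfalso
    have hev := (S.tendsto_RL 0 d).eventually (lt_mem_nhds h.1)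
    obtain ⟨e, he, he'⟩ := mem_nhdsLT_iff_exists_Ioo_subset.1 hev
    obtain ⟨x, hx, hex⟩ := exists_lt_of_lt_csSup hTne (show e < sSup T from he)
    have hxd : x < d := lt_of_le_of_ne (le_csSup hTb hx) fun h => hdT (h ▸ hx)
    exact absurd hx.2 (not_lt.2 (le_of_lt (he' ⟨hex, hxd⟩)))
  · exact h.1

/-- At a jump from the second to the fourth quadrant the jump condition gives `v 0 ≤ v 1`. To the
left of it, as long as `u'` is in the second quadrant, `v 0 - v 1` is strictly increasing, so it is
negative at the preceding entry into that quadrant. This forces `R 0 + R 1 > 0` there, which no jump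
can produce. Hence there is no preceding entry, and `u'` stays in the second quadrant on a left
half-line. -/
theorem false_of_out_of_le (S : RegulatedSol l r v L R) {c K y₀ : ℝ} (hc : 0 < c)
    (hr : ∀ i, ∀ y < y₀, c ≤ r i y ∧ r i y ≤ K) (hr' : ∀ y < y₀, r 1 y ≤ r 0 y)
    (hout : ∀ y ≤ y₀, v 0 y < 0 ∨ v 1 y < 0) : False := by
  have hR : ∀ y ≤ y₀, R 0 y * R 1 y < 0 := fun y hy => by
    have := hout y hy
    rw [S.eqR 0, S.eqR 1] at this
    exact mul_neg_of_out this
  have hL : ∀ y ≤ y₀, L 0 y * L 1 y < 0 := fun y hy => by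
    have := hout y hy
    rw [S.eqL 0, S.eqL 1] at this
    exact mul_neg_of_out this
  obtain ⟨e, hey, hLe, hRe⟩ := S.exists_jump hc hr hout
  have hsum : 0 ≤ L 0 e + L 1 e := by
    rcases S.jump e with h | h
    · rw [h 0] at hRe; exact absurd hRe (not_lt.2 hLe.le)
    · exact h.2
  have hLe1 : 0 < L 1 e := by
    rcases mul_neg_iff.1 (hL e hey.le) with h | h
    · exact absurd h.1 (not_lt.2 hLe.le)
    · exact h.2
  have hge : v 0 e - v 1 e ≤ 0 := by
    rw [S.eqL 0, S.eqL 1]; nlinarith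
  have key : ∀ x < e, L 0 x ≤ 0 := by
    by_contra! hcon
    obtain ⟨x₀, hx₀, hx₀'⟩ := hcon
    set T := {x | x < e ∧ 0 < L 0 x} with hT
    have hTne : T.Nonempty := ⟨x₀, hx₀, hx₀'⟩
    have hTb : BddAbove T := ⟨e, fun x hx => hx.1.le⟩
    set d := sSup T with hd
    have hde : d < e := by
      obtain ⟨w, hw, hw'⟩ := mem_nhdsLT_iff_exists_Ioo_subset.1
        ((S.tendsto_LL 0 e).eventually (gt_mem_nhds hLe))
      refine (csSup_le hTne fun x hx => ?_).trans_lt hw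
      by_contra! hwx
      exact absurd (hw' ⟨hwx, hx.1⟩) (not_lt.2 hx.2.le)
    have hLneg : ∀ x ∈ Ioo d e, L 0 x ≤ 0 := fun x hx => by
      by_contra! hx'
      exact absurd (le_csSup hTb ⟨hx.2, hx'⟩) (not_le.2 hx.1)
    have hRneg : ∀ x ∈ Ico d e, R 0 x < 0 ∧ 0 < R 1 x := fun x hx => by
      have : R 0 x ≤ 0 := by
        refine le_of_tendsto (S.tendsto_LR 0 x) ?_
        filter_upwards [Ioo_mem_nhdsGT hx.2] with z hz
        exact hLneg z ⟨hx.1.trans_lt hz.1, hz.2⟩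
      rcases mul_neg_iff.1 (hR x (hx.2.trans hey).le) with h | h
      · exact absurd h.1 (not_lt.2 this)
      · exact h
    have hder : ∀ x, HasDerivWithinAt (fun x => v 0 x - v 1 x)
        ((r 0 x - R 0 x) - (r 1 x - R 1 x)) (Ici x) x :=
      fun x => (S.derivR 0 x).sub (S.derivR 1 x)
    have hpos : ∀ x ∈ Ico d e, 0 < (r 0 x - R 0 x) - (r 1 x - R 1 x) := fun x hx => by
      linarith [(hRneg x hx).1, (hRneg x hx).2, hr' x (hx.2.trans hey)]
    have hgd : v 0 d - v 1 d < 0 := by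
      obtain ⟨z, hz, hz'⟩ := ((eventually_lt_of_deriv_right_pos (hder d)
        (hpos d ⟨le_rfl, hde⟩)).and (Ioo_mem_nhdsGT hde)).exists
      have := mul_sub_le_of_le_deriv_right (m := 0) hz'.2.le
        ((S.continuous 0).sub (S.continuous 1)) (fun x _ => hder x)
        (fun x hx => (hpos x ⟨hz'.1.le.trans hx.1, hx.2⟩).le)
      simp only [Pi.sub_apply] at this
      linarith
    have hRd := hRneg d ⟨le_rfl, hde⟩
    have hsd : 0 < R 0 d + R 1 d := by
      rw [S.eqR 0, S.eqR 1] at hgd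
      by_contra! hs
      nlinarith
    have hLd : L 0 d < 0 := by
      rcases S.jump d with h | h
      · rw [← h 0]; exact hRd.1
      · have := h.2
        have h0 := h.1 0
        have h1 := h.1 1
        linarith
    obtain ⟨w, hw, hw'⟩ := mem_nhdsLT_iff_exists_Ioo_subset.1
      ((S.tendsto_LL 0 d).eventually (gt_mem_nhds hLd))
    obtain ⟨x, hx, hwx⟩ := exists_lt_of_lt_csSup hTne (show w < sSup T from hw)
    have hxd : x < d := lt_of_le_of_ne (le_csSup hTb hx) fun h =>
      absurd hx.2 (not_lt.2 (h ▸ hLd.le))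
    exact absurd (hw' ⟨hwx, hxd⟩) (not_lt.2 hx.2.le)
  refine S.not_second_quadrant (y₀ := e) hc (fun i y hy => hr i y (hy.trans hey)) fun x hx => ?_
  have : R 0 x ≤ 0 := by
    refine le_of_tendsto (S.tendsto_LR 0 x) ?_
    filter_upwards [Ioo_mem_nhdsGT hx] with z hz
    exact key z hz.2
  rcases mul_neg_iff.1 (hR x (hx.trans hey).le) with h | h
  · exact absurd h.1 (not_lt.2 this)
  · exact h

theorem false_of_out (S : RegulatedSol l r v L R) {c K y₀ : ℝ} {k : Fin 2 → ℝ} (hc : 0 < c)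
    (hr : ∀ i, ∀ y < y₀, c ≤ r i y ∧ r i y ≤ K) (hr' : ∀ i, ∀ y < y₀, r i y = k i)
    (hout : ∀ y ≤ y₀, v 0 y < 0 ∨ v 1 y < 0) : False := by
  rcases le_total (k 1) (k 0) with h | h
  · exact S.false_of_out_of_le hc hr (fun y hy => by rwa [hr' 0 y hy, hr' 1 y hy]) hout
  · refine S.swap.false_of_out_of_le hc (fun _ => hr _) (fun y hy => ?_)
      (fun y hy => (hout y hy).symm)
    change r 0 y ≤ r 1 y
    rwa [hr' 0 y hy, hr' 1 y hy]

/-- The first equation factors as `p (q + p/2) = 0`, and `q = -p/2` would make the second quantity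
`-3p²/8`. On an edge of the first quadrant this makes the slope of the vanishing `v i` equal to that
of `h i`, hence positive. -/
theorem eq_zero_of_nonneg_of_eq_zero {p q : ℝ} (h0 : p * q + p ^ 2 / 2 = 0)
    (h1 : 0 ≤ p * q + q ^ 2 / 2) : p = 0 := by
  by_contra hp
  have hq : q = -p / 2 := by
    have : p * (q + p / 2) = 0 := by linarith
    rcases mul_eq_zero.1 this with h | h
    · exact absurd h hp
    · linarith
  subst hq
  have := sq_pos_of_ne_zero hp
  nlinarith

/-- The first quadrant is positively invariant for `h - u`. -/
theorem nonneg_of_nonneg (S : RegulatedSol l r v L R) (hr : ∀ i y, 0 < r i y) {a b : ℝ}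
    (hab : a ≤ b) (ha : ∀ i, 0 ≤ v i a) : ∀ i, 0 ≤ v i b := by
  have hcl : IsClosed ({x | ∀ i, 0 ≤ v i x} ∩ Icc a b) := by
    refine IsClosed.inter ?_ isClosed_Icc
    simp only [ofPred_forall]
    exact isClosed_iInter fun i => isClosed_le continuous_const (S.continuous i)
  refine hcl.Icc_subset_of_forall_mem_nhdsWithin ha ?_ (right_mem_Icc.2 hab)
  rintro x ⟨hx, -⟩
  have : ∀ i, ∀ᶠ z in 𝓝[>] x, 0 ≤ v i z := by
    intro i
    rcases (hx i).eq_or_lt with h | h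
    · have hRi : R i x = 0 := by
        have h0 := S.eqR 0 x
        have h1 := S.eqR 1 x
        have hx0 := hx 0
        have hx1 := hx 1
        fin_cases i
        · exact eq_zero_of_nonneg_of_eq_zero (h0.symm.trans h.symm) (h1 ▸ hx1)
        · refine eq_zero_of_nonneg_of_eq_zero (q := R 0 x) ?_ ?_
          · rw [mul_comm]; exact h1.symm.trans h.symm
          · rw [mul_comm]; exact h0 ▸ hx0
      have hd := S.derivR i x
      rw [hRi, sub_zero] at hd
      filter_upwards [eventually_lt_of_deriv_right_pos hd (hr i x)] with z hz
      linarith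
    · exact (((S.continuous i).tendsto x).mono_left nhdsWithin_le_nhds |>.eventually
        (lt_mem_nhds h)).mono fun z hz => hz.le
  exact eventually_all.2 this

theorem nonneg (S : RegulatedSol l r v L R) {c K x₀ : ℝ} {k : Fin 2 → ℝ} (hc : 0 < c)
    (hr : ∀ i y, c ≤ r i y ∧ r i y ≤ K) (hr' : ∀ i, ∀ y < x₀, r i y = k i) (i : Fin 2) (y : ℝ) :
    0 ≤ v i y := by
  by_contra hcon
  refine S.false_of_out (y₀ := min y x₀) hc (fun i y _ => hr i y)
    (fun i y hy => hr' i y (hy.trans_le (min_le_right _ _))) fun z hz => ?_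
  by_contra! hz'
  exact hcon (S.nonneg_of_nonneg (fun i y => hc.trans_le (hr i y).1)
    (hz.trans (min_le_left _ _)) (fun j => by fin_cases j; exacts [hz'.1, hz'.2]) i)

theorem mul_nonneg_of_nonneg {p q : ℝ} (h0 : 0 ≤ p * q + p ^ 2 / 2)
    (h1 : 0 ≤ p * q + q ^ 2 / 2) : 0 ≤ p * q := by
  by_contra! h
  rcases mul_neg_iff.1 h with h | h
  · nlinarith
  · nlinarith

/-- The limits of `u'` from the right lie in the first quadrant, away from the origin. -/
theorem right_mem_quadrant (S : RegulatedSol l r v L R) {c K x₀ : ℝ} {k : Fin 2 → ℝ} (hc : 0 < c)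
    (hr : ∀ i y, c ≤ r i y ∧ r i y ≤ K) (hr' : ∀ i, ∀ y < x₀, r i y = k i)
    (hl : ∀ i y, 0 < l i y) (y : ℝ) : 0 ≤ R 0 y ∧ 0 ≤ R 1 y ∧ 0 < R 0 y + R 1 y := by
  have hv := S.nonneg hc hr hr'
  -- At a common zero the left gradient vanishes, so `v 0` has left slope `l 0 y > 0` and would be
  -- negative just to the left.
  have hne : ∀ y, ¬ (v 0 y = 0 ∧ v 1 y = 0) := by
    rintro y ⟨h0, h1⟩
    have hL0 : L 0 y = 0 :=
      eq_zero_of_nonneg_of_eq_zero ((S.eqL 0 y).symm.trans h0) (S.eqL 1 y ▸ hv 1 y)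
    have hd := S.derivL 0 y
    rw [hL0, sub_zero] at hd
    obtain ⟨z, hz⟩ := (eventually_lt_of_deriv_left_pos hd (hl 0 y)).exists
    linarith [hv 0 z]
  have hRq : ∀ y, 0 ≤ R 0 y * R 1 y := fun y =>
    mul_nonneg_of_nonneg (S.eqR 0 y ▸ hv 0 y) (S.eqR 1 y ▸ hv 1 y)
  have hLq : ∀ y, 0 ≤ L 0 y * L 1 y := fun y =>
    mul_nonneg_of_nonneg (S.eqL 0 y ▸ hv 0 y) (S.eqL 1 y ▸ hv 1 y)
  have hRs : ∀ y, R 0 y + R 1 y ≠ 0 := fun y h => by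
    have h1 : R 1 y = -R 0 y := by linarith
    have h2 := hRq y
    have h3 : R 0 y = 0 := by rw [h1] at h2; nlinarith
    apply hne y
    rw [S.eqR 0, S.eqR 1, h1, h3]; simp
  have hLs : ∀ y, L 0 y + L 1 y ≠ 0 := fun y h => by
    have h1 : L 1 y = -L 0 y := by linarith
    have h2 := hLq y
    have h3 : L 0 y = 0 := by rw [h1] at h2; nlinarith
    apply hne y
    rw [S.eqL 0, S.eqL 1, h1, h3]; simp
  have hpos : ∀ y, 0 < R 0 y + R 1 y := by
    by_contra! hcon
    obtain ⟨a, ha⟩ := hcon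
    replace ha := lt_of_le_of_ne ha (hRs a)
    -- A negative sum persists to the right: it cannot pass through zero, and a jump requires a
    -- nonnegative sum on its left.
    have key : ∀ x ≥ a, R 0 x + R 1 x < 0 := by
      by_contra! hcon
      obtain ⟨x₁, hx₁, hx₁'⟩ := hcon
      set T := {x | a ≤ x ∧ 0 ≤ R 0 x + R 1 x} with hT
      have hTne : T.Nonempty := ⟨x₁, hx₁, hx₁'⟩
      have hTb : BddBelow T := ⟨a, fun x hx => hx.1⟩
      set d := sInf T with hd
      have had : a ≤ d := le_csInf hTne fun x hx => hx.1
      have hbefore : ∀ x, a ≤ x → x < d → R 0 x + R 1 x < 0 := fun x hx hxd => by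
        by_contra! hx'
        exact absurd (csInf_le hTb ⟨hx, hx'⟩) (not_le.2 hxd)
      have hRd : R 0 d + R 1 d < 0 := by
        rcases had.eq_or_lt with h | h
        · rwa [← h]
        · have hLd : L 0 d + L 1 d ≤ 0 := by
            refine le_of_tendsto ((S.tendsto_RL 0 d).add (S.tendsto_RL 1 d)) ?_
            filter_upwards [Ioo_mem_nhdsLT h] with z hz
            exact (hbefore z hz.1.le hz.2).le
          replace hLd := lt_of_le_of_ne hLd (hLs d)
          rcases S.jump d with h | h
          · rwa [h 0, h 1]
          · exact absurd h.2 (not_le.2 hLd)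
      obtain ⟨w, hw, hw'⟩ := mem_nhdsGT_iff_exists_Ioo_subset.1
        (((S.tendsto_RR 0 d).add (S.tendsto_RR 1 d)).eventually (gt_mem_nhds hRd))
      obtain ⟨x, hx, hxw⟩ := exists_lt_of_csInf_lt hTne (show sInf T < w from hw)
      have hdx : d < x := lt_of_le_of_ne (csInf_le hTb hx) fun h =>
        absurd hx.2 (not_le.2 (h ▸ hRd))
      exact absurd hx.2 (not_le.2 (hw' ⟨hdx, hxw⟩))
    have hneg : ∀ x ≥ a, R 0 x ≤ 0 ∧ R 1 x ≤ 0 := fun x hx => by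
      rcases mul_nonneg_iff.1 (hRq x) with h | h
      · exact absurd (key x hx) (not_lt.2 (add_nonneg h.1 h.2))
      · exact h
    obtain ⟨C, hC⟩ := S.growth
    have hder : ∀ x, HasDerivWithinAt (fun x => v 0 x + v 1 x)
        ((r 0 x - R 0 x) + (r 1 x - R 1 x)) (Ici x) x :=
      fun x => (S.derivR 0 x).add (S.derivR 1 x)
    have hcont : Continuous (fun x => v 0 x + v 1 x) := (S.continuous 0).add (S.continuous 1)
    refine false_of_le_deriv_right_atTop (f' := fun x => (r 0 x - R 0 x) + (r 1 x - R 1 x))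
      (C := C + C) hcont (fun x => ?_) fun M => ?_
    · exact (abs_add_le _ _).trans ((add_le_add (hC 0 x) (hC 1 x)).trans (by rw [add_mul]))
    · refine ⟨a + M ^ 2 / c, fun x hx => ⟨hder x, ?_⟩⟩
      have hMc : 0 ≤ M ^ 2 / c := by positivity
      have hax : a ≤ x := by linarith
      have h1 := mul_sub_le_of_le_deriv_right (m := c) hax hcont (fun x _ => hder x)
        (fun z hz => by linarith [(hr 0 z).1, (hr 1 z).1, (hneg z hz.1).1, (hneg z hz.1).2])
      have h2 : M ^ 2 ≤ c * (x - a) := by rw [← div_le_iff₀' hc]; linarith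
      -- In the third quadrant `v 0 + v 1 ≤ (R 0 + R 1)²`, so the linear increase of `v 0 + v 1`
      -- makes its own slope unbounded.
      have h3 : M ^ 2 ≤ (R 0 x + R 1 x) ^ 2 := by
        have := hv 0 a
        have := hv 1 a
        simp only [S.eqR 0 x, S.eqR 1 x] at h1
        nlinarith [sq_nonneg (R 0 x), sq_nonneg (R 1 x)]
      have h4 := abs_le_of_sq_le_sq h3
      have h5 : M ≤ -(R 0 x + R 1 x) := by
        have := key x hax
        by_contra! hM
        nlinarith
      linarith [(hr 0 x).1, (hr 1 x).1]
  have := hpos y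
  rcases mul_nonneg_iff.1 (hRq y) with h | h
  · exact ⟨h.1, h.2, this⟩
  · linarith [h.1, h.2]

end RegulatedSol

/-! ### Uniqueness by monotonicity on the first quadrant -/

namespace RegulatedSol

variable {l r v L R : Fin 2 → ℝ → ℝ}

theorem continuous_distSq {v' L' R' : Fin 2 → ℝ → ℝ} (S : RegulatedSol l r v L R)
    (S' : RegulatedSol l r v' L' R') :
    Continuous fun x => (v 0 x - v' 0 x) ^ 2 + (v 1 x - v' 1 x) ^ 2 :=
  (((S.continuous 0).sub (S'.continuous 0)).pow 2).add
    (((S.continuous 1).sub (S'.continuous 1)).pow 2)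

theorem hasDerivWithinAt_distSq {v' L' R' : Fin 2 → ℝ → ℝ} (S : RegulatedSol l r v L R)
    (S' : RegulatedSol l r v' L' R') (x : ℝ) :
    HasDerivWithinAt (fun x => (v 0 x - v' 0 x) ^ 2 + (v 1 x - v' 1 x) ^ 2)
      (-((R 0 x + R 1 x + (R' 0 x + R' 1 x)) * ((R 0 x - R' 0 x) ^ 2 +
        (R 0 x - R' 0 x) * (R 1 x - R' 1 x) + (R 1 x - R' 1 x) ^ 2))) (Ici x) x := by
  have h := (((S.derivR 0 x).fun_sub (S'.derivR 0 x)).fun_pow 2).fun_add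
    (((S.derivR 1 x).fun_sub (S'.derivR 1 x)).fun_pow 2)
  refine h.congr_deriv ?_
  rw [S.eqR 0 x, S.eqR 1 x, S'.eqR 0 x, S'.eqR 1 x]
  push_cast
  ring

/-- The difference of the two images is linear in `(a, b)`, with diagonal coefficient half the total
sum and off-diagonal coefficients between `0` and that. The quadratic form on the right is at least
`(a² + b²) / 2`. -/
theorem distSq_le {p q p' q' : ℝ} (hp : 0 ≤ p) (hq : 0 ≤ q) (hp' : 0 ≤ p') (hq' : 0 ≤ q') :
    ((p * q + p ^ 2 / 2) - (p' * q' + p' ^ 2 / 2)) ^ 2 +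
      ((p * q + q ^ 2 / 2) - (p' * q' + q' ^ 2 / 2)) ^ 2 ≤
    2 * (p + q + (p' + q')) ^ 2 * ((p - p') ^ 2 + (p - p') * (q - q') + (q - q') ^ 2) := by
  set a := p - p' with ha
  set b := q - q' with hb
  have key : ∀ s t a b : ℝ, 0 ≤ t → t ≤ s → (s * a + t * b) ^ 2 ≤ 2 * s ^ 2 * (a ^ 2 + b ^ 2) := by
    intro s t a b ht hts
    have : t ^ 2 ≤ s ^ 2 := pow_le_pow_left₀ ht hts 2
    nlinarith [sq_nonneg (s * a - t * b), mul_le_mul_of_nonneg_right this (sq_nonneg b)]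
  have e0 : (p * q + p ^ 2 / 2) - (p' * q' + p' ^ 2 / 2) =
      ((p + q + (p' + q')) / 2) * a + ((p + p') / 2) * b := by rw [ha, hb]; ring
  have e1 : (p * q + q ^ 2 / 2) - (p' * q' + q' ^ 2 / 2) =
      ((p + q + (p' + q')) / 2) * b + ((q + q') / 2) * a := by rw [ha, hb]; ring
  rw [e0, e1]
  have k0 := key ((p + q + (p' + q')) / 2) ((p + p') / 2) a b (by positivity) (by linarith)
  have k1 := key ((p + q + (p' + q')) / 2) ((q + q') / 2) b a (by positivity) (by linarith)
  nlinarith [mul_nonneg (sq_nonneg (p + q + (p' + q'))) (sq_nonneg (a + b))]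

/-- A nonnegative function that grows at most quadratically at `-∞` and satisfies
`4 E ≤ -(A - x) E'` vanishes on the negative half-line. -/
theorem eq_zero_of_deriv_right_le {E E' : ℝ → ℝ} {A D : ℝ} (hA : 1 ≤ A) (hD : 0 ≤ D)
    (hEc : Continuous E) (hE0 : ∀ x, 0 ≤ E x) (hder : ∀ x, HasDerivWithinAt E (E' x) (Ici x) x)
    (hE' : ∀ x ≤ 0, 4 * E x ≤ (A - x) * -E' x) (hup : ∀ x ≤ 0, E x ≤ D * (A - x) ^ 2) :
    ∀ x ≤ 0, E x = 0 := by
  intro x₀ hx₀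
  by_contra hne
  have hpos : 0 < E x₀ := lt_of_le_of_ne (hE0 _) (Ne.symm hne)
  have hAx : ∀ x ≤ 0, 0 < A - x := fun x hx => by linarith
  have hmono : ∀ y ≤ x₀, E x₀ * (A - y) ^ 4 ≤ E y * (A - x₀) ^ 4 := by
    intro y hy
    -- `Z` solves `4 Z = -(A - x) Z'` with `Z y = E y`. The perturbation by `ε` below supplies the
    -- strict inequality needed at contact points.
    set Z : ℝ → ℝ := fun x => E y * (A - x) ^ 4 / (A - y) ^ 4 with hZ
    have hZd : ∀ x, HasDerivAt Z (E y * (4 * (A - x) ^ 3 * (-1)) / (A - y) ^ 4) x := fun x => by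
      have := ((((hasDerivAt_id x).const_sub A).fun_pow 4).const_mul (E y)).div_const
        ((A - y) ^ 4)
      refine this.congr_deriv ?_
      simp
    have hy4 : 0 < (A - y) ^ 4 := pow_pos (hAx y (hy.trans hx₀)) 4
    have hle : ∀ ε > 0, E x₀ ≤ Z x₀ + ε * (x₀ - y + 1) := by
      intro ε hε
      have hWd : ∀ x, HasDerivAt (fun x => Z x + ε * (x - y + 1))
          (E y * (4 * (A - x) ^ 3 * (-1)) / (A - y) ^ 4 + ε) x := fun x => by
        have := (hZd x).fun_add ((((hasDerivAt_id x).sub_const y).add_const 1).const_mul ε)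
        exact this.congr_deriv (by rw [mul_one])
      refine image_le_of_deriv_right_lt_deriv_boundary (a := y) (b := x₀) hEc.continuousOn
        (fun x _ => hder x) ?_ hWd ?_ (right_mem_Icc.2 hy)
      · simp only [hZ, mul_div_cancel_right₀ _ hy4.ne']; linarith
      · intro x hx hxe
        have hx0 : x ≤ 0 := hx.2.le.trans hx₀
        have hAxx := hAx x hx0
        have h3 : E y * (4 * (A - x) ^ 3 * (-1)) / (A - y) ^ 4 = -(4 * Z x) / (A - x) := by
          simp only [hZ]; field_simp
        have h4 : Z x ≤ E x := by
          have : 0 ≤ ε * (x - y + 1) := mul_nonneg hε.le (by linarith [hx.1])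
          linarith
        rw [h3]
        have h5 : E' x ≤ -(4 * Z x) / (A - x) := by
          rw [le_div_iff₀ hAxx]
          linarith [hE' x hx0]
        linarith
    have hZle : E x₀ ≤ Z x₀ := by
      refine le_of_forall_pos_le_add fun δ hδ => ?_
      have hp : 0 < x₀ - y + 1 := by linarith
      have := hle (δ / (x₀ - y + 1)) (div_pos hδ hp)
      rwa [div_mul_cancel₀ _ hp.ne'] at this
    exact (le_div_iff₀ hy4).1 hZle
  set B := D * (A - x₀) ^ 4 / E x₀ with hB
  have hB0 : 0 ≤ B := by positivity
  obtain ⟨y, hy⟩ : ∃ y, y = x₀ - B - 1 := ⟨_, rfl⟩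
  have hyx : y ≤ x₀ := by linarith
  have h1 := hmono y hyx
  have h2 := hup y (hyx.trans hx₀)
  have hAy := hAx y (hyx.trans hx₀)
  have h3 : E x₀ * (A - y) ^ 4 ≤ D * (A - x₀) ^ 4 * (A - y) ^ 2 :=
    h1.trans ((mul_le_mul_of_nonneg_right h2 (pow_nonneg (hAx x₀ hx₀).le 4)).trans_eq (by ring))
  have h4 : E x₀ * (A - y) ^ 2 ≤ D * (A - x₀) ^ 4 := by
    refine le_of_mul_le_mul_right ?_ (pow_pos hAy 2)
    calc _ = E x₀ * (A - y) ^ 4 := by ring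
      _ ≤ _ := h3
  have h5 : (A - y) ^ 2 ≤ B := by rw [hB, le_div_iff₀ hpos]; linarith
  have h6 : B + 1 ≤ A - y := by have := hAx x₀ hx₀; linarith
  clear_value B
  nlinarith

/-- Solutions with `u'` in the first quadrant are unique. -/
theorem eq_of_right_mem_quadrant {v' L' R' : Fin 2 → ℝ → ℝ} (S : RegulatedSol l r v L R)
    (S' : RegulatedSol l r v' L' R')
    (hR : ∀ x, 0 ≤ R 0 x ∧ 0 ≤ R 1 x ∧ 0 < R 0 x + R 1 x)
    (hR' : ∀ x, 0 ≤ R' 0 x ∧ 0 ≤ R' 1 x ∧ 0 < R' 0 x + R' 1 x) : v = v' := by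
  set E : ℝ → ℝ := fun x => (v 0 x - v' 0 x) ^ 2 + (v 1 x - v' 1 x) ^ 2 with hE
  set Q : ℝ → ℝ := fun x => (R 0 x - R' 0 x) ^ 2 +
        (R 0 x - R' 0 x) * (R 1 x - R' 1 x) + (R 1 x - R' 1 x) ^ 2 with hQ
  set s : ℝ → ℝ := fun x => R 0 x + R 1 x + (R' 0 x + R' 1 x) with hs
  have hder : ∀ x, HasDerivWithinAt E (-(s x * Q x)) (Ici x) x := S.hasDerivWithinAt_distSq S'
  have hEc : Continuous E := S.continuous_distSq S'
  have hE0 : ∀ x, 0 ≤ E x := fun x => by positivity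
  have hQ0 : ∀ x, 0 ≤ Q x := fun x => by
    simp only [hQ]
    nlinarith [sq_nonneg (R 0 x - R' 0 x + (R 1 x - R' 1 x)), sq_nonneg (R 0 x - R' 0 x),
      sq_nonneg (R 1 x - R' 1 x)]
  have hs0 : ∀ x, 0 < s x := fun x => add_pos (hR x).2.2 (hR' x).2.2
  have hEQ : ∀ x, E x ≤ 2 * s x ^ 2 * Q x := fun x => by
    simp only [hE, S.eqR 0 x, S.eqR 1 x, S'.eqR 0 x, S'.eqR 1 x]
    exact distSq_le (hR x).1 (hR x).2.1 (hR' x).1 (hR' x).2.1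
  have hanti : ∀ {a b}, a ≤ b → E b ≤ E a := fun {a b} hab => by
    have := sub_le_mul_of_deriv_right_le (m := 0) hab hEc (fun x _ => hder x)
      (fun x _ => neg_nonpos.2 (mul_nonneg (hs0 x).le (hQ0 x)))
    linarith
  obtain ⟨C₁, hC₁⟩ := S.growth
  obtain ⟨C₂, hC₂⟩ := S'.growth
  set C := max C₁ C₂ with hC
  have hC1 : ∀ i x, |v i x| ≤ C * (1 + |x|) := fun i x =>
    (hC₁ i x).trans (mul_le_mul_of_nonneg_right (le_max_left _ _) (by positivity))
  have hC2 : ∀ i x, |v' i x| ≤ C * (1 + |x|) := fun i x =>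
    (hC₂ i x).trans (mul_le_mul_of_nonneg_right (le_max_right _ _) (by positivity))
  have hC0 : 0 ≤ C := by have := (abs_nonneg _).trans (hC1 0 0); simpa using this
  -- Large enough that `16 C (1 - x) ≤ ((A - x) / 8)²`; the factor `1/8` then yields the exponent
  -- `4` in the decay inequality.
  set A := 1024 * C + 1 with hA
  have hsA : ∀ x ≤ 0, s x ≤ (A - x) / 8 := fun x hx => by
    have h1 : s x ^ 2 ≤ 16 * (C * (1 - x)) := by
      have e0 := (abs_le.1 (hC1 0 x)).2
      have e1 := (abs_le.1 (hC1 1 x)).2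
      have e2 := (abs_le.1 (hC2 0 x)).2
      have e3 := (abs_le.1 (hC2 1 x)).2
      rw [abs_of_nonpos hx, ← sub_eq_add_neg] at e0 e1 e2 e3
      rw [S.eqR] at e0 e1
      rw [S'.eqR] at e2 e3
      have m1 := mul_nonneg (hR x).1 (hR x).2.1
      have m2 := mul_nonneg (hR' x).1 (hR' x).2.1
      simp only [hs]
      nlinarith [sq_nonneg (R 0 x + R 1 x - (R' 0 x + R' 1 x))]
    have h2 : 0 ≤ C * (1 - x) := mul_nonneg hC0 (by linarith)
    have h3 : 0 ≤ (A - x) / 8 := by rw [hA]; linarith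
    refine abs_le_of_sq_le_sq' ?_ h3 |>.2
    rw [hA]
    nlinarith [sq_nonneg (1024 * C), sq_nonneg (1 - x)]
  have hup : ∀ y ≤ 0, E y ≤ 8 * C ^ 2 * (A - y) ^ 2 := fun y hy => by
    have hb : ∀ i, (v i y - v' i y) ^ 2 ≤ 4 * C ^ 2 * (A - y) ^ 2 := fun i => by
      have e0 := hC1 i y
      have e1 := hC2 i y
      rw [abs_of_nonpos hy, ← sub_eq_add_neg] at e0 e1
      have h1 : |v i y - v' i y| ≤ 2 * (C * (1 - y)) := (abs_sub _ _).trans (by linarith)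
      have h2 : 2 * (C * (1 - y)) ≤ 2 * (C * (A - y)) := by
        have : C * (1 - y) ≤ C * (A - y) :=
          mul_le_mul_of_nonneg_left (by rw [hA]; linarith) hC0
        linarith
      have h3 := pow_le_pow_left₀ (abs_nonneg _) (h1.trans h2) 2
      rw [sq_abs] at h3
      linarith [h3, mul_pow C (A - y) 2]
    have := hb 0
    have := hb 1
    simp only [hE]
    linarith
  have hzero : ∀ x ≤ 0, E x = 0 := by
    refine eq_zero_of_deriv_right_le (D := 8 * C ^ 2) (by rw [hA]; linarith) (by positivity) hEc
      hE0 hder (fun x hx => ?_) hup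
    rw [neg_neg]
    have h1 := hEQ x
    have h2 := mul_le_mul_of_nonneg_right (hsA x hx) (mul_nonneg (hs0 x).le (hQ0 x))
    linarith [(by ring : s x * (s x * Q x) = s x ^ 2 * Q x)]
  have hall : ∀ x, E x = 0 := fun x => by
    rcases le_total x 0 with h | h
    · exact hzero x h
    · exact le_antisymm ((hanti h).trans (hzero 0 le_rfl).le) (hE0 x)
  ext i x
  have := hall x
  simp only [hE] at this
  have h0 : v 0 x - v' 0 x = 0 := by nlinarith [sq_nonneg (v 0 x - v' 0 x), sq_nonneg (v 1 x - v' 1 x)]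
  have h1 : v 1 x - v' 1 x = 0 := by nlinarith [sq_nonneg (v 0 x - v' 0 x), sq_nonneg (v 1 x - v' 1 x)]
  fin_cases i
  · exact sub_eq_zero.1 h0
  · exact sub_eq_zero.1 h1

end RegulatedSol

/-! ### Piecewise linear costs -/

/-- One-sided slopes of the costs, with uniform bounds, and constant far on the left. -/
structure HasSlopes (h l r : Fin 2 → ℝ → ℝ) (c K x₀ : ℝ) (k : Fin 2 → ℝ) : Prop where
  pos : 0 < c
  derivR : ∀ i y, HasDerivWithinAt (h i) (r i y) (Ici y) y
  derivL : ∀ i y, HasDerivWithinAt (h i) (l i y) (Iic y) y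
  boundR : ∀ i y, c ≤ r i y ∧ r i y ≤ K
  boundL : ∀ i y, c ≤ l i y ∧ l i y ≤ K
  bound : ∀ i, c ≤ k i ∧ k i ≤ K
  left : ∀ i, ∀ y < x₀, HasDerivAt (h i) (k i) y

theorem Ioo_subset_piece {N : ℕ} {x : Fin N → ℝ} (hx : StrictMono x) {a b : ℝ}
    (hab : ∀ k, x k ≤ a ∨ b ≤ x k) : ∃ j, Ioo a b ⊆ piece x j := by
  classical
  -- The index of the piece is the number of breakpoints not exceeding `a`; by monotonicity these
  -- are the first ones.
  set T : Finset (Fin N) := Finset.univ.filter fun k => x k ≤ a with hT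
  have hcard : T.card < N + 1 := by
    have := Finset.card_le_univ T
    rw [Fintype.card_fin] at this
    omega
  have hmem : ∀ k : Fin N, k.1 < T.card ↔ x k ≤ a := by
    intro k
    constructor
    · intro hk
      by_contra hcon
      have : T ⊆ Finset.Iio k := fun m hm => by
        rw [Finset.mem_Iio]
        by_contra! hkm
        exact hcon ((hx.monotone hkm).trans (Finset.mem_filter.1 hm).2)
      have := Finset.card_le_card this
      rw [Fin.card_Iio] at this
      omega
    · intro hk
      have : Finset.Iic k ⊆ T := fun m hm =>
        Finset.mem_filter.2 ⟨Finset.mem_univ _, (hx.monotone (Finset.mem_Iic.1 hm)).trans hk⟩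
      have := Finset.card_le_card this
      rw [Fin.card_Iic] at this
      omega
  refine ⟨⟨T.card, hcard⟩, fun z hz k => ⟨fun hk => ?_, fun hk => ?_⟩⟩
  · exact ((hmem k).1 hk).trans_lt hz.1
  · rcases hab k with h | h
    · have := (hmem k).2 h
      have hk' : T.card ≤ k.1 := hk
      omega
    · exact hz.2.trans_le h

namespace IsPiecewiseLinear

variable {N : ℕ} {x : Fin N → ℝ} {κ : Fin (N + 1) → Fin 2 → ℝ} {h : Fin 2 → ℝ → ℝ}

theorem exists_derivR (hh : IsPiecewiseLinear x κ h) (y : ℝ) :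
    ∃ j, ∀ i, HasDerivWithinAt (h i) (κ j i) (Ici y) y := by
  have : ∀ᶠ b in 𝓝[>] y, ∀ k, x k ≤ y ∨ b ≤ x k := by
    refine eventually_all.2 fun k => ?_
    rcases le_or_gt (x k) y with hk | hk
    · exact Eventually.of_forall fun _ => Or.inl hk
    · filter_upwards [Ioo_mem_nhdsGT hk] with b hb using Or.inr hb.2.le
  obtain ⟨b, hb, hyb⟩ := (this.and self_mem_nhdsWithin).exists
  obtain ⟨j, hj⟩ := Ioo_subset_piece hh.breakpoints hb
  refine ⟨j, fun i => hasDerivWithinAt_Ici_of_tendsto_deriv (s := Ioo y b) ?_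
    (hh.continuous i).continuousWithinAt (Ioo_mem_nhdsGT hyb) ?_⟩
  · exact fun z hz => (hh.slope j z (hj hz) i).differentiableAt.differentiableWithinAt
  · refine tendsto_const_nhds.congr' ?_
    filter_upwards [Ioo_mem_nhdsGT hyb] with z hz using (hh.slope j z (hj hz) i).deriv.symm

theorem exists_derivL (hh : IsPiecewiseLinear x κ h) (y : ℝ) :
    ∃ j, ∀ i, HasDerivWithinAt (h i) (κ j i) (Iic y) y := by
  have : ∀ᶠ a in 𝓝[<] y, ∀ k, x k ≤ a ∨ y ≤ x k := by
    refine eventually_all.2 fun k => ?_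
    rcases le_or_gt y (x k) with hk | hk
    · exact Eventually.of_forall fun _ => Or.inr hk
    · filter_upwards [Ioo_mem_nhdsLT hk] with b hb using Or.inl hb.1.le
  obtain ⟨a, ha, hya⟩ := (this.and self_mem_nhdsWithin).exists
  obtain ⟨j, hj⟩ := Ioo_subset_piece hh.breakpoints ha
  refine ⟨j, fun i => hasDerivWithinAt_Iic_of_tendsto_deriv (s := Ioo a y) ?_
    (hh.continuous i).continuousWithinAt (Ioo_mem_nhdsLT hya) ?_⟩
  · exact fun z hz => (hh.slope j z (hj hz) i).differentiableAt.differentiableWithinAt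
  · refine tendsto_const_nhds.congr' ?_
    filter_upwards [Ioo_mem_nhdsLT hya] with z hz using (hh.slope j z (hj hz) i).deriv.symm

theorem exists_hasSlopes (hh : IsPiecewiseLinear x κ h) (hκ : ∀ j i, 0 < κ j i) :
    ∃ l r c K x₀ k, HasSlopes h l r c K x₀ k := by
  choose jr hjr using hh.exists_derivR
  choose jl hjl using hh.exists_derivL
  obtain ⟨K, hK⟩ := Finite.exists_le fun p : Fin (N + 1) × Fin 2 => κ p.1 p.2
  obtain ⟨p₀, hp₀⟩ := Finite.exists_min fun p : Fin (N + 1) × Fin 2 => κ p.1 p.2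
  obtain ⟨x₀, hx₀⟩ := Finite.exists_ge x
  refine ⟨fun i y => κ (jl y) i, fun i y => κ (jr y) i, κ p₀.1 p₀.2, K, x₀, κ 0,
    hκ _ _, fun i y => hjr y i, fun i y => hjl y i, fun i y => ⟨hp₀ (_, i), hK (_, i)⟩,
    fun i y => ⟨hp₀ (_, i), hK (_, i)⟩, fun i => ⟨hp₀ (_, i), hK (_, i)⟩,
    fun i y hy => hh.slope 0 y (fun k => ⟨fun hk => ?_, fun _ => hy.trans_le (hx₀ k)⟩) i⟩
  exact absurd hk (not_lt.2 (Fin.zero_le _))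

end IsPiecewiseLinear

namespace HasSlopes

variable {h l r : Fin 2 → ℝ → ℝ} {c K x₀ : ℝ} {k : Fin 2 → ℝ}

theorem le_K (H : HasSlopes h l r c K x₀ k) : c ≤ K := (H.bound 0).1.trans (H.bound 0).2

theorem right_eq (H : HasSlopes h l r c K x₀ k) (i : Fin 2) {y : ℝ} (hy : y < x₀) :
    r i y = k i :=
  (uniqueDiffWithinAt_Ici y).eq_deriv _ (H.derivR i y) ((H.left i y hy).hasDerivWithinAt)

theorem continuous (H : HasSlopes h l r c K x₀ k) (i : Fin 2) : Continuous (h i) :=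
  continuous_iff_continuousAt.2 fun y => continuousAt_iff_continuous_left_right.2
    ⟨(H.derivL i y).continuousWithinAt, (H.derivR i y).continuousWithinAt⟩

theorem lipschitz (H : HasSlopes h l r c K x₀ k) (i : Fin 2) :
    LipschitzWith (Real.toNNReal K) (h i) := by
  have hK : 0 ≤ K := H.pos.le.trans H.le_K
  have key : ∀ a b, a ≤ b → |h i a - h i b| ≤ K * (b - a) := fun a b hab => by
    have h1 := mul_sub_le_of_le_deriv_right hab (H.continuous i) (fun x _ => H.derivR i x)
      (fun x _ => (H.boundR i x).1)
    have h2 := sub_le_mul_of_deriv_right_le hab (H.continuous i) (fun x _ => H.derivR i x)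
      (fun x _ => (H.boundR i x).2)
    have h3 : 0 ≤ c * (b - a) := mul_nonneg H.pos.le (by linarith)
    rw [abs_le]; constructor <;> linarith
  refine LipschitzWith.of_dist_le_mul fun a b => ?_
  rw [Real.coe_toNNReal _ hK, Real.dist_eq, Real.dist_eq]
  rcases le_total a b with hab | hab
  · rw [abs_sub_comm a b, abs_of_nonneg (sub_nonneg.2 hab)]; exact key a b hab
  · rw [abs_of_nonneg (sub_nonneg.2 hab), abs_sub_comm]; exact key b a hab

theorem growth (H : HasSlopes h l r c K x₀ k) :
    ∃ C, ∀ i y, |h i y| ≤ C * (1 + |y|) := by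
  have hK : 0 ≤ K := H.pos.le.trans H.le_K
  refine ⟨|h 0 0| + |h 1 0| + K, fun i y => ?_⟩
  have h1 := (H.lipschitz i).dist_le_mul y 0
  rw [Real.coe_toNNReal _ hK, Real.dist_eq, Real.dist_eq, sub_zero] at h1
  have h2 : |h i 0| ≤ |h 0 0| + |h 1 0| := by
    fin_cases i
    · exact le_add_of_nonneg_right (abs_nonneg _)
    · exact le_add_of_nonneg_left (abs_nonneg _)
  have h3 : |h i y| ≤ |h i y - h i 0| + |h i 0| := by
    have := abs_add_le (h i y - h i 0) (h i 0)
    rwa [sub_add_cancel] at this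
  have h4 : 0 ≤ (|h 0 0| + |h 1 0|) * |y| := by positivity
  nlinarith

end HasSlopes

/-! ### From admissible to regulated solutions -/

theorem neBot_nhdsGT_inf_ae (y : ℝ) : (𝓝[>] y ⊓ ae (volume : Measure ℝ)).NeBot := by
  refine inf_neBot_iff.2 fun {s} hs {t} ht => ?_
  obtain ⟨b, hb, hbs⟩ := mem_nhdsGT_iff_exists_Ioo_subset.1 hs
  by_contra hcon
  rw [not_nonempty_iff_eq_empty] at hcon
  have hsub : Ioo y b ⊆ tᶜ := fun z hz hzt => by
    have : z ∈ s ∩ t := ⟨hbs hz, hzt⟩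
    rw [hcon] at this
    exact this
  have := measure_mono_null hsub (mem_ae_iff.1 ht)
  rw [Real.volume_Ioo, ENNReal.ofReal_eq_zero] at this
  exact absurd this (not_le.2 (sub_pos.2 hb))

theorem neBot_nhdsLT_inf_ae (y : ℝ) : (𝓝[<] y ⊓ ae (volume : Measure ℝ)).NeBot := by
  refine inf_neBot_iff.2 fun {s} hs {t} ht => ?_
  obtain ⟨b, hb, hbs⟩ := mem_nhdsLT_iff_exists_Ioo_subset.1 hs
  by_contra hcon
  rw [not_nonempty_iff_eq_empty] at hcon
  have hsub : Ioo b y ⊆ tᶜ := fun z hz hzt => by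
    have : z ∈ s ∩ t := ⟨hbs hz, hzt⟩
    rw [hcon] at this
    exact this
  have := measure_mono_null hsub (mem_ae_iff.1 ht)
  rw [Real.volume_Ioo, ENNReal.ofReal_eq_zero] at this
  exact absurd this (not_le.2 (sub_pos.2 hb))

/-- One-sided essential limits inherit the one-sided essential limit of the function. -/
theorem tendsto_of_tendsto_inf_ae {f g : ℝ → ℝ} {ℓ : Filter ℝ} {d : ℝ}
    (hℓ : ∀ s ∈ ℓ, ∀ᶠ z in ℓ, s ∈ 𝓝 z) (hf : Tendsto f (ℓ ⊓ ae volume) (𝓝 d))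
    (m : ℝ → Filter ℝ) (hm : ∀ z, m z ≤ 𝓝 z) (hne : ∀ z, (m z ⊓ ae volume).NeBot)
    (hg : ∀ z, Tendsto f (m z ⊓ ae volume) (𝓝 (g z))) : Tendsto g ℓ (𝓝 d) := by
  refine (closed_nhds_basis d).tendsto_right_iff.2 fun V hV => ?_
  obtain ⟨s, hs, t, ht, hst⟩ := mem_inf_iff_superset.1 (hf hV.1)
  filter_upwards [hℓ s hs] with z hz
  have := hne z
  refine hV.2.mem_of_tendsto (hg z) ?_
  filter_upwards [mem_inf_of_left (hm z hz), mem_inf_of_right ht] with w hw hw'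
  exact hst ⟨hw, hw'⟩

theorem eventually_mem_nhds_nhdsGT (y : ℝ) : ∀ s ∈ 𝓝[>] y, ∀ᶠ z in 𝓝[>] y, s ∈ 𝓝 z := by
  intro s hs
  obtain ⟨b, hb, hbs⟩ := mem_nhdsGT_iff_exists_Ioo_subset.1 hs
  filter_upwards [Ioo_mem_nhdsGT hb] with z hz
  exact mem_of_superset (Ioo_mem_nhds hz.1 hz.2) hbs

theorem eventually_mem_nhds_nhdsLT (y : ℝ) : ∀ s ∈ 𝓝[<] y, ∀ᶠ z in 𝓝[<] y, s ∈ 𝓝 z := by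
  intro s hs
  obtain ⟨b, hb, hbs⟩ := mem_nhdsLT_iff_exists_Ioo_subset.1 hs
  filter_upwards [Ioo_mem_nhdsLT hb] with z hz
  exact mem_of_superset (Ioo_mem_nhds hz.1 hz.2) hbs

/-- Two gradients satisfying the system at the same point agree up to the sign. -/
theorem eq_or_eq_neg_of_eq {a b c d : ℝ} (h0 : a * b + a ^ 2 / 2 = c * d + c ^ 2 / 2)
    (h1 : a * b + b ^ 2 / 2 = c * d + d ^ 2 / 2) : (a = c ∧ b = d) ∨ (a = -c ∧ b = -d) := by
  have hD : (a + b) * (a - b) = (c + d) * (c - d) := by linarith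
  have hS : 3 * (a + b) ^ 2 - (a - b) ^ 2 = 3 * (c + d) ^ 2 - (c - d) ^ 2 := by linarith
  -- For `w = √3 (a + b) + i (a - b)`, `hS` and `hD` compare the real and imaginary parts of `w²`;
  -- this step compares `|w|²`.
  have hN : 3 * (a + b) ^ 2 + (a - b) ^ 2 = 3 * (c + d) ^ 2 + (c - d) ^ 2 := by
    refine (pow_left_inj₀ (by positivity) (by positivity) two_ne_zero).1 ?_
    have e1 : (3 * (a + b) ^ 2 + (a - b) ^ 2) ^ 2 =
      (3 * (a + b) ^ 2 - (a - b) ^ 2) ^ 2 + 12 * ((a + b) * (a - b)) ^ 2 := by ring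
    have e2 : (3 * (c + d) ^ 2 + (c - d) ^ 2) ^ 2 =
      (3 * (c + d) ^ 2 - (c - d) ^ 2) ^ 2 + 12 * ((c + d) * (c - d)) ^ 2 := by ring
    rw [e1, e2, hS, hD]
  have hs : (a + b) ^ 2 = (c + d) ^ 2 := by linarith
  have hd : (a - b) ^ 2 = (c - d) ^ 2 := by linarith
  rcases eq_or_ne (a + b) 0 with hz | hz
  · have hz' : c + d = 0 := by rw [hz] at hs; exact pow_eq_zero_iff two_ne_zero |>.1 (by linarith)
    rcases sq_eq_sq_iff_eq_or_eq_neg.1 hd with h | h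
    · exact Or.inl ⟨by linarith, by linarith⟩
    · exact Or.inr ⟨by linarith, by linarith⟩
  · rcases sq_eq_sq_iff_eq_or_eq_neg.1 hs with h | h
    · rw [← h] at hD
      have := mul_left_cancel₀ hz hD
      exact Or.inl ⟨by linarith, by linarith⟩
    · have : a - b = -(c - d) := mul_left_cancel₀ hz (by rw [hD, h]; ring)
      exact Or.inr ⟨by linarith, by linarith⟩

namespace IsAdmissible

variable {h u l r : Fin 2 → ℝ → ℝ} {c K x₀ : ℝ} {k : Fin 2 → ℝ}

theorem continuous (A : IsAdmissible h u) (i : Fin 2) : Continuous (u i) := by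
  refine continuous_iff_continuousAt.2 fun y => ?_
  have := (A.absolutelyContinuous i (y - 1) (y + 1)).continuousOn
  rw [uIcc_of_le (by linarith)] at this
  exact this.continuousAt (Icc_mem_nhds (by linarith) (by linarith))

theorem eq_add_integral (A : IsAdmissible h u) (i : Fin 2) (y : ℝ) :
    u i = fun z => u i y + ∫ t in y..z, deriv (u i) t := by
  ext z
  rw [(A.absolutelyContinuous i y z).integral_deriv_eq_sub]
  ring

theorem hasDerivWithinAt_Ici (A : IsAdmissible h u) (i : Fin 2) {y d : ℝ}
    (hd : Tendsto (deriv (u i)) (𝓝[>] y ⊓ ae volume) (𝓝 d)) :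
    HasDerivWithinAt (u i) d (Ici y) y := by
  rw [A.eq_add_integral i y]
  refine HasDerivWithinAt.const_add _ ?_
  exact intervalIntegral.integral_hasDerivWithinAt_of_tendsto_ae_right (by simp)
    ((stronglyMeasurable_deriv (u i)).stronglyMeasurableAtFilter) hd

theorem hasDerivWithinAt_Iic (A : IsAdmissible h u) (i : Fin 2) {y d : ℝ}
    (hd : Tendsto (deriv (u i)) (𝓝[<] y ⊓ ae volume) (𝓝 d)) :
    HasDerivWithinAt (u i) d (Iic y) y := by
  rw [A.eq_add_integral i y]
  refine HasDerivWithinAt.const_add _ ?_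
  refine intervalIntegral.integral_hasDerivWithinAt_of_tendsto_ae_right (t := Iic y) (by simp)
    ((stronglyMeasurable_deriv (u i)).stronglyMeasurableAtFilter) ?_
  -- The point `y` itself is a null set.
  have : 𝓝[≤] y ⊓ ae (volume : Measure ℝ) ≤ 𝓝[<] y ⊓ ae volume := by
    refine le_inf ?_ inf_le_right
    have hne : {y}ᶜ ∈ ae (volume : Measure ℝ) := by simp [mem_ae_iff]
    refine (inf_le_inf_left _ (le_principal_iff.2 hne)).trans ?_
    rw [← nhdsWithin_inter']
    exact nhdsWithin_mono _ fun z hz => lt_of_le_of_ne hz.1 hz.2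
  exact hd.mono_left this

theorem exists_regulatedSol (A : IsAdmissible h u) (H : HasSlopes h l r c K x₀ k) :
    ∃ L R, RegulatedSol l r (fun i y => h i y - u i y) L R := by
  choose pr pl hr hl hj using A.jumps
  have hD : derivDomain u ∈ ae (volume : Measure ℝ) := A.equation.mono fun x hx => hx.1
  -- Limits along the full-measure set `derivDomain u` are essential limits, so the default value of
  -- `deriv` elsewhere plays no role.
  have toD : ∀ s y, 𝓝[s] y ⊓ ae (volume : Measure ℝ) ≤ 𝓝[s ∩ derivDomain u] y := fun s y => by
    rw [nhdsWithin_inter']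
    exact inf_le_inf_left _ (le_principal_iff.2 hD)
  have hr' : ∀ i y, Tendsto (deriv (u i)) (𝓝[>] y ⊓ ae volume) (𝓝 (pr y i)) := fun i y =>
    (hr y i).mono_left (toD _ _)
  have hl' : ∀ i y, Tendsto (deriv (u i)) (𝓝[<] y ⊓ ae volume) (𝓝 (pl y i)) := fun i y =>
    (hl y i).mono_left (toD _ _)
  have heq : ∀ (i : Fin 2) (y : ℝ) (F : Filter ℝ) (q : Fin 2 → ℝ), F ≤ 𝓝 y →
      (F ⊓ ae volume).NeBot → (∀ i, Tendsto (deriv (u i)) (F ⊓ ae volume) (𝓝 (q i))) →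
      h i y - u i y = q 0 * q 1 + q i ^ 2 / 2 := by
    intro i y F q hF hne hq
    have h1 : Tendsto (fun z => h i z - u i z) (F ⊓ ae volume) (𝓝 (h i y - u i y)) :=
      (((H.continuous i).sub (A.continuous i)).tendsto y).mono_left (inf_le_left.trans hF)
    have h2 : Tendsto (fun z => h i z - u i z) (F ⊓ ae volume) (𝓝 (q 0 * q 1 + q i ^ 2 / 2)) := by
      refine (((hq 0).mul (hq 1)).add (((hq i).pow 2).div_const 2)).congr' ?_
      filter_upwards [mem_inf_of_right A.equation] with z hz
      have := hz.2 i
      linarith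
    exact tendsto_nhds_unique h1 h2
  have eqR : ∀ i y, h i y - u i y = pr y 0 * pr y 1 + pr y i ^ 2 / 2 := fun i y =>
    heq i y _ _ nhdsWithin_le_nhds (neBot_nhdsGT_inf_ae y) fun i => hr' i y
  have eqL : ∀ i y, h i y - u i y = pl y 0 * pl y 1 + pl y i ^ 2 / 2 := fun i y =>
    heq i y _ _ nhdsWithin_le_nhds (neBot_nhdsLT_inf_ae y) fun i => hl' i y
  refine ⟨fun i y => pl y i, fun i y => pr y i, ?_⟩
  refine ⟨fun i => (H.continuous i).sub (A.continuous i),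
    fun i y => (H.derivR i y).sub (A.hasDerivWithinAt_Ici i (hr' i y)),
    fun i y => (H.derivL i y).sub (A.hasDerivWithinAt_Iic i (hl' i y)),
    fun i y => tendsto_of_tendsto_inf_ae (eventually_mem_nhds_nhdsGT y) (hr' i y) (fun z => 𝓝[>] z)
      (fun z => nhdsWithin_le_nhds) neBot_nhdsGT_inf_ae (hr' i),
    fun i y => tendsto_of_tendsto_inf_ae (eventually_mem_nhds_nhdsGT y) (hr' i y) (fun z => 𝓝[<] z)
      (fun z => nhdsWithin_le_nhds) neBot_nhdsLT_inf_ae (hl' i),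
    fun i y => tendsto_of_tendsto_inf_ae (eventually_mem_nhds_nhdsLT y) (hl' i y) (fun z => 𝓝[<] z)
      (fun z => nhdsWithin_le_nhds) neBot_nhdsLT_inf_ae (hl' i),
    fun i y => tendsto_of_tendsto_inf_ae (eventually_mem_nhds_nhdsLT y) (hl' i y) (fun z => 𝓝[>] z)
      (fun z => nhdsWithin_le_nhds) neBot_nhdsGT_inf_ae (hr' i),
    eqR, eqL, fun y => ?_, ?_⟩
  · rcases eq_or_ne (pr y) (pl y) with hy | hy
    · exact Or.inl fun i => congrFun hy i
    · rcases eq_or_eq_neg_of_eq ((eqR 0 y).symm.trans (eqL 0 y))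
        ((eqR 1 y).symm.trans (eqL 1 y)) with ⟨h0, h1⟩ | ⟨h0, h1⟩
      · refine Or.inl fun i => ?_
        fin_cases i
        exacts [h0, h1]
      · refine Or.inr ⟨fun i => ?_, ?_⟩
        · fin_cases i
          exacts [h0, h1]
        -- When the gradient changes sign, the two alternatives of (A3) coincide.
        · rcases hj y hy with h2 | h2
          · linarith
          · exact h2
  · obtain ⟨C₁, hC₁⟩ := H.growth
    obtain ⟨C₂, hC₂⟩ := A.growth
    refine ⟨C₁ + C₂, fun i y => (abs_sub _ _).trans ?_⟩
    rw [add_mul]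
    exact add_le_add (hC₁ i y) (hC₂ i y)

theorem unique {u' : Fin 2 → ℝ → ℝ} (H : HasSlopes h l r c K x₀ k) (A : IsAdmissible h u)
    (A' : IsAdmissible h u') : u = u' := by
  obtain ⟨L, R, S⟩ := A.exists_regulatedSol H
  obtain ⟨L', R', S'⟩ := A'.exists_regulatedSol H
  have hl : ∀ i y, 0 < l i y := fun i y => H.pos.trans_le (H.boundL i y).1
  have := S.eq_of_right_mem_quadrant S'
    (S.right_mem_quadrant H.pos H.boundR (fun i y => H.right_eq i) hl)
    (S'.right_mem_quadrant H.pos H.boundR (fun i y => H.right_eq i) hl)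
  ext i y
  have := congrFun (congrFun this i) y
  linarith

end IsAdmissible

/-! ### Existence of a classical solution -/

/-- Global existence for an ordinary differential equation with a bounded and globally Lipschitz
vector field. -/
theorem exists_forall_hasDerivAt {E : Type*} [NormedAddCommGroup E] [NormedSpace ℝ E]
    [CompleteSpace E] {f : ℝ → E → E} {K M : NNReal} (hf : ∀ t, LipschitzWith K (f t))
    (hc : ∀ x, Continuous fun t => f t x) (hM : ∀ t x, ‖f t x‖ ≤ M) (t₀ : ℝ) (x₀ : E) :
    ∃ α : ℝ → E, α t₀ = x₀ ∧ ∀ t, HasDerivAt α (f t (α t)) t := by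
  have hloc : ∀ n : ℕ, ∃ α : ℝ → E, α t₀ = x₀ ∧
      ∀ t ∈ Ioo (t₀ - (n + 1)) (t₀ + (n + 1)), HasDerivAt α (f t (α t)) t := by
    intro n
    have hmem : t₀ ∈ Icc (t₀ - ((n : ℝ) + 1)) (t₀ + (n + 1)) := by
      constructor <;> linarith [(Nat.cast_nonneg n : (0 : ℝ) ≤ n)]
    have hp : IsPicardLindelof f (⟨t₀, hmem⟩ : Icc (t₀ - ((n : ℝ) + 1)) (t₀ + (n + 1))) x₀
        (M * (n + 1)) 0 M K :=
      { lipschitzOnWith := fun t _ => (hf t).lipschitzOnWith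
        continuousOn := fun x _ => (hc x).continuousOn
        norm_le := fun t _ x _ => hM t x
        mul_max_le := by
          simp }
    obtain ⟨α, h0, h1⟩ := hp.exists_eq_forall_mem_Icc_hasDerivWithinAt₀
    exact ⟨α, h0, fun t ht => (h1 t (Ioo_subset_Icc_self ht)).hasDerivAt (Icc_mem_nhds ht.1 ht.2)⟩
  choose α h0 h1 using hloc
  have hmem : ∀ (n : ℕ) (z : ℝ), ⌈|z - t₀|⌉₊ ≤ n → z ∈ Ioo (t₀ - ((n : ℝ) + 1)) (t₀ + (n + 1)) := by
    intro n z hn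
    have h2 := (Nat.le_ceil |z - t₀|).trans (Nat.cast_le.2 hn)
    have h3 := abs_le.1 h2
    constructor <;> linarith [h3.1, h3.2]
  have hmono : ∀ n m : ℕ, n ≤ m → EqOn (α n) (α m) (Ioo (t₀ - ((n : ℝ) + 1)) (t₀ + (n + 1))) := by
    intro n m hnm
    have hnm' : (n : ℝ) ≤ m := Nat.cast_le.2 hnm
    refine ODE_solution_unique_of_mem_Ioo (v := f) (s := fun _ => univ) (t₀ := t₀)
      (fun t _ => (hf t).lipschitzOnWith) ?_ (fun t ht => ⟨h1 n t ht, mem_univ _⟩)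
      (fun t ht => ⟨h1 m t ⟨by linarith [ht.1], by linarith [ht.2]⟩, mem_univ _⟩)
      ((h0 n).trans (h0 m).symm)
    constructor <;> linarith [(Nat.cast_nonneg n : (0 : ℝ) ≤ n)]
  -- The `n`-th solution lives on radius `n + 1`, so `t` is interior to the interval of the chosen
  -- one.
  refine ⟨fun t => α ⌈|t - t₀|⌉₊ t, h0 _, fun t => ?_⟩
  set n := ⌈|t - t₀|⌉₊ with hn
  have ht := hmem n t le_rfl
  refine (h1 n t ht).congr_of_eventuallyEq ?_
  filter_upwards [Ioo_mem_nhds ht.1 ht.2] with z hz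
  rcases le_total ⌈|z - t₀|⌉₊ n with h | h
  · exact hmono _ _ h (hmem _ z le_rfl)
  · exact (hmono _ _ h hz).symm

/-- With `s = p + q` and `D = p - q` the equations become `s D = 2 (a - b)` and `3 s² - D² = 4 (a +
b)`, a quadratic equation for `s²`. Positivity of `p` and `q` is `|D| < s`, which follows from `ab >
0`. -/
theorem exists_pos_gradient {a b : ℝ} (ha : 0 < a) (hb : 0 < b) :
    ∃ p q : ℝ, 0 < p ∧ 0 < q ∧ p * q + p ^ 2 / 2 = a ∧ p * q + q ^ 2 / 2 = b := by
  set t := √((a + b) ^ 2 + 3 * (a - b) ^ 2) with ht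
  have ht2 : t ^ 2 = (a + b) ^ 2 + 3 * (a - b) ^ 2 := Real.sq_sqrt (by positivity)
  have ht0 : 0 ≤ t := Real.sqrt_nonneg _
  set s := √(2 / 3 * (a + b + t)) with hs
  have hs2 : s ^ 2 = 2 / 3 * (a + b + t) := Real.sq_sqrt (by positivity)
  have hs0 : 0 < s := Real.sqrt_pos.2 (by positivity)
  obtain ⟨D, hD⟩ : ∃ D, D = 2 * (a - b) / s := ⟨_, rfl⟩
  have hDs : D * s = 2 * (a - b) := by rw [hD]; field_simp
  have hlt : 2 * |a - b| < t := by
    refine lt_of_pow_lt_pow_left₀ 2 ht0 ?_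
    rw [mul_pow, sq_abs, ht2]
    nlinarith [mul_pos ha hb]
  have hab : |a - b| < a + b := abs_lt.2 ⟨by linarith, by linarith⟩
  have hDlt : |D| < s := by
    have h1 : |D| * s = 2 * |a - b| := by
      calc |D| * s = |D * s| := by rw [abs_mul, abs_of_pos hs0]
        _ = 2 * |a - b| := by rw [hDs, abs_mul, abs_two]
    refine lt_of_mul_lt_mul_right ?_ hs0.le
    rw [h1, ← sq, hs2]
    linarith
  have hD2 : D ^ 2 = 3 * s ^ 2 - 4 * (a + b) := by
    have h1 : D ^ 2 * s ^ 2 = 4 * (a - b) ^ 2 := by rw [← mul_pow, hDs]; ring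
    refine mul_right_cancel₀ (pow_pos hs0 2).ne' ?_
    rw [h1, hs2]
    nlinarith
  have := abs_lt.1 hDlt
  refine ⟨(s + D) / 2, (s - D) / 2, by linarith, by linarith, ?_, ?_⟩ <;> nlinarith

/-- The monotonicity identity of the uniqueness proof becomes strong monotonicity once both sums of
components are at least `c`. -/
theorem abs_sub_le_of_pos_gradient {p q p' q' a b a' b' c : ℝ} (hc : 0 < c) (hp : 0 < p)
    (hq : 0 < q) (hp' : 0 < p') (hq' : 0 < q') (h0 : p * q + p ^ 2 / 2 = a)
    (h1 : p * q + q ^ 2 / 2 = b) (h0' : p' * q' + p' ^ 2 / 2 = a') (h1' : p' * q' + q' ^ 2 / 2 = b')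
    (ha : c ^ 2 / 2 ≤ a) (ha' : c ^ 2 / 2 ≤ a') :
    |p - p'| + |q - q'| ≤ 4 / c * (|a - a'| + |b - b'|) := by
  have hs : c ≤ p + q := by
    refine le_of_sq_le_sq ?_ (by positivity)
    nlinarith [mul_pos hp hq]
  have hs' : c ≤ p' + q' := by
    refine le_of_sq_le_sq ?_ (by positivity)
    nlinarith [mul_pos hp' hq']
  have key : (a - a') * (p - p') + (b - b') * (q - q') =
      (p + q + (p' + q')) / 2 * ((p - p') ^ 2 + (p - p') * (q - q') + (q - q') ^ 2) := by
    rw [← h0, ← h1, ← h0', ← h1']; ring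
  set x := p - p'
  set y := q - q'
  have hQ : (|x| + |y|) ^ 2 / 4 ≤ x ^ 2 + x * y + y ^ 2 := by
    have e : (|x| + |y|) ^ 2 + (|x| - |y|) ^ 2 = 2 * (x ^ 2 + y ^ 2) := by
      rw [← sq_abs x, ← sq_abs y]; ring
    nlinarith [sq_nonneg (|x| - |y|), sq_nonneg (x + y)]
  have hup : (a - a') * x + (b - b') * y ≤ (|a - a'| + |b - b'|) * (|x| + |y|) := by
    have e1 : (a - a') * x ≤ |a - a'| * |x| := by rw [← abs_mul]; exact le_abs_self _
    have e2 : (b - b') * y ≤ |b - b'| * |y| := by rw [← abs_mul]; exact le_abs_self _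
    nlinarith [mul_nonneg (abs_nonneg (a - a')) (abs_nonneg y),
      mul_nonneg (abs_nonneg (b - b')) (abs_nonneg x)]
  have hlow : c * ((|x| + |y|) ^ 2 / 4) ≤
      (p + q + (p' + q')) / 2 * (x ^ 2 + x * y + y ^ 2) :=
    mul_le_mul (by linarith) hQ (by positivity) (by positivity)
  rcases (add_nonneg (abs_nonneg x) (abs_nonneg y)).eq_or_lt with h | h
  · rw [← h]; positivity
  · have h2 : c * (|x| + |y|) / 4 ≤ |a - a'| + |b - b'| := by
      refine le_of_mul_le_mul_right ?_ h
      calc _ = c * ((|x| + |y|) ^ 2 / 4) := by ring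
        _ ≤ _ := hlow.trans (key ▸ hup)
    rw [div_mul_eq_mul_div, le_div_iff₀ hc]
    linarith

/-- A bounded Lipschitz extension of the inverse of `p ↦ (p₁p₂ + p₁²/2, p₁p₂ + p₂²/2)` on a
square contained in the first quadrant. -/
theorem exists_lipschitz_gradient {c K : ℝ} (hc : 0 < c) (hcK : c ≤ K) :
    ∃ Φ : (Fin 2 → ℝ) → Fin 2 → ℝ, (∀ w i, 0 < Φ w i ∧ Φ w i ≤ 2 * (K + 1)) ∧
      (∀ w w' i, |Φ w i - Φ w' i| ≤ 4 / c * (|w 0 - w' 0| + |w 1 - w' 1|)) ∧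
      (∀ w, (∀ i, c ^ 2 / 2 ≤ w i ∧ w i ≤ 3 / 2 * (K + 1) ^ 2) →
        ∀ i, Φ w 0 * Φ w 1 + Φ w i ^ 2 / 2 = w i) ∧
      (∀ w i, w i = c ^ 2 / 2 → Φ w i < c) ∧
      ∀ w i, w i = 3 / 2 * (K + 1) ^ 2 → K + 1 ≤ Φ w i := by
  have hK : 0 < K := hc.trans_le hcK
  -- On the lower edge `p i ^ 2 / 2 < c ^ 2 / 2`, so `p i < c`. On the upper edge `p i` is the
  -- larger component, so the edge value is at most `3/2 * p i ^ 2` and `p i ≥ K + 1`. With slopes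
  -- of `h` in `[c, K]`, `h - u` therefore cannot leave the square.
  set a := c ^ 2 / 2 with ha
  set b := 3 / 2 * (K + 1) ^ 2 with hb
  have ha0 : 0 < a := by positivity
  have hab : a ≤ b := by rw [ha, hb]; nlinarith
  set cl : ℝ → ℝ := fun t => projIcc a b hab t with hcl
  have hcla : ∀ t, a ≤ cl t := fun t => (projIcc a b hab t).2.1
  have hclb : ∀ t, cl t ≤ b := fun t => (projIcc a b hab t).2.2
  have hcl1 : ∀ s t, |cl s - cl t| ≤ |s - t| := fun s t => by
    have := (LipschitzWith.projIcc hab).dist_le_mul s t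
    simpa [Subtype.dist_eq, Real.dist_eq] using this
  have hclid : ∀ t, a ≤ t → t ≤ b → cl t = t := fun t h1 h2 => by
    simp only [hcl, projIcc_of_mem hab ⟨h1, h2⟩]
  choose P Q hP hQ hPQ hPQ' using fun w : Fin 2 → ℝ =>
    exists_pos_gradient (ha0.trans_le (hcla (w 0))) (ha0.trans_le (hcla (w 1)))
  have hsq : ∀ x y z : ℝ, 0 < x → 0 < y → x * y + x ^ 2 / 2 = z → z ≤ b → x ≤ 2 * (K + 1) := by
    intro x y z hx hy hz hzb
    refine le_of_sq_le_sq ?_ (by positivity)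
    nlinarith [mul_pos hx hy]
  refine ⟨fun w => ![P w, Q w], fun w i => ?_, fun w w' i => ?_, fun w hw i => ?_, fun w i hi => ?_,
    fun w i hi => ?_⟩
  · fin_cases i
    · exact ⟨hP w, hsq _ _ _ (hP w) (hQ w) (hPQ w) (hclb _)⟩
    · exact ⟨hQ w, hsq _ _ _ (hQ w) (hP w) (by rw [mul_comm]; exact hPQ' w) (hclb _)⟩
  · have h1 := abs_sub_le_of_pos_gradient hc (hP w) (hQ w) (hP w') (hQ w') (hPQ w) (hPQ' w)
      (hPQ w') (hPQ' w') (hcla _) (hcla _)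
    have h2 : 4 / c * (|cl (w 0) - cl (w' 0)| + |cl (w 1) - cl (w' 1)|) ≤
        4 / c * (|w 0 - w' 0| + |w 1 - w' 1|) :=
      mul_le_mul_of_nonneg_left (add_le_add (hcl1 _ _) (hcl1 _ _)) (by positivity)
    have h3 := h1.trans h2
    fin_cases i
    · exact (le_add_of_nonneg_right (abs_nonneg _)).trans h3
    · exact (le_add_of_nonneg_left (abs_nonneg _)).trans h3
  · fin_cases i
    · exact (hPQ w).trans (hclid _ (hw 0).1 (hw 0).2)
    · exact (hPQ' w).trans (hclid _ (hw 1).1 (hw 1).2)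
  · have e : ∀ x y : ℝ, 0 < x → 0 < y → x * y + x ^ 2 / 2 = cl (w i) → x < c := by
      intro x y hx hy h
      rw [hi, hclid a le_rfl hab, ha] at h
      refine lt_of_pow_lt_pow_left₀ 2 hc.le ?_
      nlinarith [mul_pos hx hy]
    fin_cases i
    · exact e _ _ (hP w) (hQ w) (hPQ w)
    · exact e _ _ (hQ w) (hP w) (by rw [mul_comm]; exact hPQ' w)
  · have e : ∀ x y z : ℝ, 0 < x → 0 < y → x * y + x ^ 2 / 2 = cl (w i) →
        x * y + y ^ 2 / 2 = z → z ≤ b → K + 1 ≤ x := by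
      intro x y z hx hy h h' hz
      rw [hi, hclid b hab le_rfl] at h
      have hyx : y ≤ x := le_of_sq_le_sq (by linarith) hx.le
      refine le_of_sq_le_sq ?_ hx.le
      nlinarith
    fin_cases i
    · exact e _ _ _ (hP w) (hQ w) (hPQ w) (hPQ' w) (hclb _)
    · exact e _ _ _ (hQ w) (hP w) (by rw [mul_comm]; exact hPQ' w)
        (by rw [mul_comm]; exact hPQ w) (hclb _)

/-- A classical solution of the system, with gradient in the first quadrant. -/
structure IsClassicalSol (h u p : Fin 2 → ℝ → ℝ) (M : ℝ) : Prop where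
  nonneg : 0 ≤ M
  hasDerivAt : ∀ i x, HasDerivAt (u i) (p i x) x
  bound : ∀ i x, |p i x| ≤ M
  lipschitz : ∃ K, ∀ i, LipschitzWith K (p i)
  equation : ∀ i x, u i x = h i x - p 0 x * p 1 x - p i x ^ 2 / 2

theorem HasSlopes.exists_isClassicalSol {h l r : Fin 2 → ℝ → ℝ} {c K x₀ : ℝ} {k : Fin 2 → ℝ}
    (H : HasSlopes h l r c K x₀ k) : ∃ u p M, IsClassicalSol h u p M := by
  have hcK := H.le_K
  have hc := H.pos
  have hK : 0 < K := hc.trans_le hcK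
  obtain ⟨Φ, hΦ, hΦL, hΦF, hΦa, hΦb⟩ := exists_lipschitz_gradient hc hcK
  have hM : 0 ≤ 2 * (K + 1) := by positivity
  have hL : 0 ≤ 8 / c := by positivity
  set f : ℝ → (Fin 2 → ℝ) → Fin 2 → ℝ := fun t w => Φ fun i => h i t - w i with hf
  have hfL : ∀ t, LipschitzWith (Real.toNNReal (8 / c)) (f t) := fun t => by
    refine LipschitzWith.of_dist_le_mul fun w w' => ?_
    rw [Real.coe_toNNReal _ hL]
    refine (dist_pi_le_iff (by positivity)).2 fun i => ?_
    have h1 := hΦL (fun i => h i t - w i) (fun i => h i t - w' i) i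
    have h2 : ∀ i, |h i t - w i - (h i t - w' i)| ≤ dist w w' := fun i => by
      rw [sub_sub_sub_cancel_left, abs_sub_comm, ← Real.dist_eq]
      exact dist_le_pi_dist w w' i
    rw [Real.dist_eq]
    refine h1.trans ?_
    calc _ ≤ 4 / c * (dist w w' + dist w w') :=
          mul_le_mul_of_nonneg_left (add_le_add (h2 0) (h2 1)) (by positivity)
      _ = _ := by ring
  have hΦc : Continuous Φ := by
    have : LipschitzWith (Real.toNNReal (8 / c)) Φ := by
      refine LipschitzWith.of_dist_le_mul fun w w' => ?_
      rw [Real.coe_toNNReal _ hL]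
      refine (dist_pi_le_iff (by positivity)).2 fun i => ?_
      rw [Real.dist_eq]
      refine (hΦL w w' i).trans ?_
      rw [← Real.dist_eq, ← Real.dist_eq]
      calc _ ≤ 4 / c * (dist w w' + dist w w') :=
            mul_le_mul_of_nonneg_left (add_le_add (dist_le_pi_dist w w' 0)
              (dist_le_pi_dist w w' 1)) (by positivity)
        _ = _ := by ring
    exact this.continuous
  have hfc : ∀ w, Continuous fun t => f t w := fun w =>
    hΦc.comp (continuous_pi fun i => (H.continuous i).sub continuous_const)
  have hfM : ∀ t w, ‖f t w‖ ≤ (Real.toNNReal (2 * (K + 1)) : ℝ) := fun t w => by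
    rw [Real.coe_toNNReal _ hM]
    refine (pi_norm_le_iff_of_nonneg hM).2 fun i => ?_
    rw [Real.norm_eq_abs, abs_of_pos (hΦ _ i).1]
    exact (hΦ _ i).2
  -- Strictly left of `x₀`, so that `h` has the slopes `k` up to and including `x₁`.
  set x₁ := x₀ - 1 with hx₁
  set F : Fin 2 → ℝ := fun i => k 0 * k 1 + k i ^ 2 / 2 with hF
  have hk : ∀ i, 0 < k i := fun i => hc.trans_le (H.bound i).1
  have hFbox : ∀ i, c ^ 2 / 2 ≤ F i ∧ F i ≤ 3 / 2 * (K + 1) ^ 2 := fun i => by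
    have h0 := hk 0
    have h1 := hk 1
    have hi := hk i
    have e1 : c ^ 2 ≤ k i ^ 2 := pow_le_pow_left₀ hc.le (H.bound i).1 2
    have e2 : k i ^ 2 ≤ K ^ 2 := pow_le_pow_left₀ hi.le (H.bound i).2 2
    have e3 : k 0 * k 1 ≤ K * K := mul_le_mul (H.bound 0).2 (H.bound 1).2 h1.le hK.le
    have e4 := mul_pos h0 h1
    simp only [hF]
    constructor <;> nlinarith
  have hΦk : Φ F = k := by
    have e0 := hΦF F hFbox 0
    have e1 := hΦF F hFbox 1
    rcases eq_or_eq_neg_of_eq e0 e1 with ⟨g0, g1⟩ | ⟨g0, g1⟩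
    · ext i
      fin_cases i
      exacts [g0, g1]
    · have := (hΦ F 0).1
      have := hk 0
      linarith
  obtain ⟨U, hU0, hU⟩ := exists_forall_hasDerivAt hfL hfc hfM x₁ (fun i => h i x₁ - F i)
  have hUi : ∀ i x, HasDerivAt (fun x => U x i) (Φ (fun i => h i x - U x i) i) x := fun i x =>
    hasDerivAt_pi.1 (hU x) i
  have hUc : ∀ i, Continuous fun x => U x i := fun i =>
    continuous_iff_continuousAt.2 fun x => (hUi i x).continuousAt
  -- The constant `h - U = F` solves the equation there because `Φ F = k`.
  have hleft : ∀ x ≤ x₁, ∀ i, h i x - U x i = F i := by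
    intro x hx
    have hd : ∀ t < x₀, HasDerivAt (fun t => (fun i => h i t - F i : Fin 2 → ℝ))
        (f t fun i => h i t - F i) t := fun t ht => by
      refine hasDerivAt_pi.2 fun i => ?_
      have : f t (fun i => h i t - F i) = k := by
        simp only [hf, sub_sub_cancel]
        exact hΦk
      rw [this]
      exact (H.left i t ht).sub_const _
    have := ODE_solution_unique_of_mem_Icc_left (v := f) (s := fun _ => univ) (a := x) (b := x₁)
      (f := U) (g := fun t i => h i t - F i) (fun t _ => (hfL t).lipschitzOnWith)
      (fun t _ => (hU t).continuousAt.continuousWithinAt) (fun t _ => (hU t).hasDerivWithinAt)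
      (fun t _ => mem_univ _)
      (fun t ht => (hd t (by linarith [ht.2])).continuousAt.continuousWithinAt)
      (fun t ht => (hd t (by linarith [ht.2])).hasDerivWithinAt) (fun t _ => mem_univ _) hU0
      ⟨le_rfl, hx⟩
    intro i
    rw [this]
    ring
  have hvd : ∀ i x, HasDerivWithinAt (fun x => h i x - U x i)
      (r i x - Φ (fun i => h i x - U x i) i) (Ici x) x := fun i x =>
    (H.derivR i x).sub (hUi i x).hasDerivWithinAt
  have hvc : ∀ i, Continuous fun x => h i x - U x i := fun i => (H.continuous i).sub (hUc i)
  have hbox : ∀ x i, c ^ 2 / 2 ≤ h i x - U x i ∧ h i x - U x i ≤ 3 / 2 * (K + 1) ^ 2 := by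
    intro x i
    rcases le_total x x₁ with hx | hx
    · rw [hleft x hx i]; exact hFbox i
    have hstart := hleft x₁ le_rfl i
    constructor
    · refine neg_le_neg_iff.1 ?_
      refine image_le_of_deriv_right_lt_deriv_boundary (f := fun x => -(h i x - U x i))
        (B := fun _ => -(c ^ 2 / 2)) (B' := fun _ => 0) (a := x₁) (b := x) (hvc i).neg.continuousOn
        (fun x _ => (hvd i x).neg) ?_ (fun x => hasDerivAt_const _ _) ?_ (right_mem_Icc.2 hx)
      · simp only [hstart]; exact neg_le_neg (hFbox i).1
      · intro z _ hz
        have := hΦa (fun i => h i z - U z i) i (neg_inj.1 hz)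
        linarith [(H.boundR i z).1]
    · refine image_le_of_deriv_right_lt_deriv_boundary (f := fun x => (h i x - U x i))
        (B := fun _ => 3 / 2 * (K + 1) ^ 2) (B' := fun _ => 0) (a := x₁) (b := x)
        (hvc i).continuousOn
        (fun x _ => (hvd i x)) ?_ (fun x => hasDerivAt_const _ _) ?_ (right_mem_Icc.2 hx)
      · simp only [hstart]; exact (hFbox i).2
      · intro z _ hz
        have := hΦb (fun i => h i z - U z i) i hz
        linarith [(H.boundR i z).2]
  have hpb : ∀ i x, |Φ (fun i => h i x - U x i) i| ≤ 2 * (K + 1) := fun i x => by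
    rw [abs_of_pos (hΦ _ i).1]; exact (hΦ _ i).2
  have hUL : ∀ i x y, |U x i - U y i| ≤ 2 * (K + 1) * |x - y| := fun i x y => by
    have := lipschitzWith_of_nnnorm_deriv_le (𝕜 := ℝ) (C := Real.toNNReal (2 * (K + 1)))
      (f := fun x => U x i) (fun x => (hUi i x).differentiableAt) (fun x => by
        rw [(hUi i x).deriv, ← NNReal.coe_le_coe, Real.coe_toNNReal _ hM, coe_nnnorm]
        exact hpb i x)
    have := this.dist_le_mul x y
    rwa [Real.coe_toNNReal _ hM] at this
  have hhL : ∀ i x y, |h i x - h i y| ≤ K * |x - y| := fun i x y => by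
    have := (H.lipschitz i).dist_le_mul x y
    rwa [Real.coe_toNNReal _ hK.le] at this
  refine ⟨fun i x => U x i, fun i x => Φ (fun i => h i x - U x i) i, 2 * (K + 1), hM, hUi, hpb,
    ⟨Real.toNNReal (4 / c * (2 * (K + 2 * (K + 1)))), fun i => ?_⟩, fun i x => ?_⟩
  · refine LipschitzWith.of_dist_le_mul fun x y => ?_
    rw [Real.coe_toNNReal _ (by positivity), Real.dist_eq, Real.dist_eq]
    refine (hΦL _ _ i).trans ?_
    have e : ∀ i, |h i x - U x i - (h i y - U y i)| ≤ (K + 2 * (K + 1)) * |x - y| := fun i => by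
      have : h i x - U x i - (h i y - U y i) = (h i x - h i y) - (U x i - U y i) := by ring
      rw [this, add_mul]
      exact (abs_sub _ _).trans (add_le_add (hhL i x y) (hUL i x y))
    calc _ ≤ 4 / c * ((K + 2 * (K + 1)) * |x - y| + (K + 2 * (K + 1)) * |x - y|) :=
          mul_le_mul_of_nonneg_left (add_le_add (e 0) (e 1)) (by positivity)
      _ = _ := by ring
  · have := hΦF (fun i => h i x - U x i) (hbox x) i
    linarith

namespace IsClassicalSol

variable {h u p : Fin 2 → ℝ → ℝ} {M : ℝ}

theorem deriv_eq (S : IsClassicalSol h u p M) (i : Fin 2) : deriv (u i) = p i :=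
  funext fun x => (S.hasDerivAt i x).deriv

theorem continuous_gradient (S : IsClassicalSol h u p M) (i : Fin 2) : Continuous (p i) := by
  obtain ⟨K, hK⟩ := S.lipschitz
  exact (hK i).continuous

theorem lipschitzWith (S : IsClassicalSol h u p M) (i : Fin 2) :
    LipschitzWith (Real.toNNReal M) (u i) :=
  lipschitzWith_of_nnnorm_deriv_le (𝕜 := ℝ) (fun x => (S.hasDerivAt i x).differentiableAt)
    fun x => by
      rw [(S.hasDerivAt i x).deriv, ← NNReal.coe_le_coe, Real.coe_toNNReal _ S.nonneg, coe_nnnorm]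
      exact S.bound i x

theorem growth (S : IsClassicalSol h u p M) : ∃ C, ∀ i x, |u i x| ≤ C * (1 + |x|) := by
  refine ⟨|u 0 0| + |u 1 0| + M, fun i y => ?_⟩
  have h1 := (S.lipschitzWith i).dist_le_mul y 0
  rw [Real.coe_toNNReal _ S.nonneg, Real.dist_eq, Real.dist_eq, sub_zero] at h1
  have h2 : |u i 0| ≤ |u 0 0| + |u 1 0| := by
    fin_cases i
    · exact le_add_of_nonneg_right (abs_nonneg _)
    · exact le_add_of_nonneg_left (abs_nonneg _)
  have h3 : |u i y| ≤ |u i y - u i 0| + |u i 0| := by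
    have := abs_add_le (u i y - u i 0) (u i 0)
    rwa [sub_add_cancel] at this
  have h4 : 0 ≤ (|u 0 0| + |u 1 0|) * |y| := by positivity
  have := S.nonneg
  nlinarith

theorem isAdmissible (S : IsClassicalSol h u p M) : IsAdmissible h u where
  absolutelyContinuous i a b :=
    ((S.lipschitzWith i).lipschitzOnWith).absolutelyContinuousOnInterval
  equation := Eventually.of_forall fun x =>
    ⟨fun i => (S.hasDerivAt i x).differentiableAt, fun i => by
      rw [S.deriv_eq, S.deriv_eq, S.deriv_eq]; exact S.equation i x⟩
  growth := S.growth
  jumps y := by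
    refine ⟨fun i => p i y, fun i => p i y, fun i => ?_, fun i => ?_, fun h => absurd rfl h⟩
    · rw [S.deriv_eq]; exact (S.continuous_gradient i).continuousAt.mono_left nhdsWithin_le_nhds
    · rw [S.deriv_eq]; exact (S.continuous_gradient i).continuousAt.mono_left nhdsWithin_le_nhds

end IsClassicalSol

/-! ### Trajectories, verification and the Nash property -/

namespace IsCaratheodorySol

variable {f : ℝ → ℝ → ℝ} {y V : ℝ} {z : ℝ → ℝ}

theorem ae_hasDerivAt (Z : IsCaratheodorySol f y z) :
    ∀ᵐ t : ℝ, 0 < t → HasDerivAt z (f t (z t)) t :=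
  (ae_restrict_iff' measurableSet_Ioi).1 Z.equation

theorem abs_sub_le (Z : IsCaratheodorySol f y z)
    (hV : ∀ᵐ t ∂(volume.restrict (Ioi (0 : ℝ))), |f t (z t)| ≤ V) {s t : ℝ} (hs : 0 ≤ s)
    (ht : 0 ≤ t) : |z t - z s| ≤ V * |t - s| := by
  have hT := Z.absolutelyContinuous (max s t) (hs.trans (le_max_left _ _))
  have hsub : uIcc s t ⊆ uIcc 0 (max s t) := by
    rw [uIcc_of_le (hs.trans (le_max_left s t))]
    exact Icc_subset_Icc (le_inf hs ht) le_rfl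
  rw [← (hT.mono hsub).integral_deriv_eq_sub, ← Real.norm_eq_abs]
  refine intervalIntegral.norm_integral_le_of_norm_le_const_ae ?_
  filter_upwards [Z.ae_hasDerivAt, (ae_restrict_iff' measurableSet_Ioi).1 hV] with τ h1 h2 hτ
  have hτ0 : 0 < τ := (le_inf hs ht).trans_lt hτ.1
  rw [(h1 hτ0).deriv]
  exact h2 hτ0

theorem continuousOn (Z : IsCaratheodorySol f y z) : ContinuousOn z (Ioi 0) := by
  intro t ht
  have h := (Z.absolutelyContinuous (t + 1) (by linarith [mem_Ioi.1 ht])).continuousOn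
  rw [uIcc_of_le (by linarith [mem_Ioi.1 ht])] at h
  exact (h.continuousAt (Icc_mem_nhds ht (by linarith))).continuousWithinAt

theorem lipschitzOnWith (Z : IsCaratheodorySol f y z) (hV0 : 0 ≤ V)
    (hV : ∀ᵐ t ∂(volume.restrict (Ioi (0 : ℝ))), |f t (z t)| ≤ V) :
    LipschitzOnWith (Real.toNNReal V) z (Ici 0) :=
  LipschitzOnWith.of_dist_le_mul fun t ht s hs => by
    rw [Real.coe_toNNReal _ hV0]
    exact Z.abs_sub_le hV hs ht

theorem abs_le (Z : IsCaratheodorySol f y z)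
    (hV : ∀ᵐ t ∂(volume.restrict (Ioi (0 : ℝ))), |f t (z t)| ≤ V) {t : ℝ} (ht : 0 ≤ t) :
    |z t| ≤ |y| + V * t := by
  have h1 := Z.abs_sub_le hV le_rfl ht
  rw [Z.initial, sub_zero, abs_of_nonneg ht] at h1
  have h2 := abs_add_le (z t - y) y
  rw [sub_add_cancel] at h2
  linarith

end IsCaratheodorySol

/-- Provides the integrable majorant for discounted costs of linear growth, and the decay of the
discounted value. -/
theorem exp_neg_mul_le {a b t : ℝ} (hb : 0 ≤ b) (ha : 0 ≤ a) (ht : 0 ≤ t) :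
    Real.exp (-t) * (a + b * t) ≤ (a + 2 * b) * Real.exp (-(1 / 2) * t) := by
  have h1 : t / 2 + 1 ≤ Real.exp (t / 2) := Real.add_one_le_exp _
  have h2 : Real.exp (-t) * Real.exp (t / 2) = Real.exp (-(1 / 2) * t) := by
    rw [← Real.exp_add]; congr 1; ring
  rw [← h2]
  have h3 : a + b * t ≤ (a + 2 * b) * Real.exp (t / 2) := by
    have := mul_le_mul_of_nonneg_left h1 (by positivity : 0 ≤ a + 2 * b)
    nlinarith [mul_nonneg ha ht]
  calc _ ≤ Real.exp (-t) * ((a + 2 * b) * Real.exp (t / 2)) :=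
        mul_le_mul_of_nonneg_left h3 (Real.exp_pos _).le
    _ = _ := by ring

theorem tendsto_exp_half_atTop (a : ℝ) :
    Tendsto (fun t : ℝ => a * Real.exp (-(1 / 2) * t)) atTop (𝓝 0) := by
  have : Tendsto (fun t : ℝ => -(1 / 2) * t) atTop atBot :=
    tendsto_id.const_mul_atTop_of_neg (by norm_num)
  simpa using (Real.tendsto_exp_atBot.comp this).const_mul a

theorem integrableOn_costIntegrand {g z β : ℝ → ℝ} {b C y V : ℝ} (hg : Continuous g)
    (hgC : ∀ x, |g x| ≤ C * (1 + |x|)) (hV0 : 0 ≤ V) (hz : ContinuousOn z (Ioi 0))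
    (hzV : ∀ t, 0 ≤ t → |z t| ≤ |y| + V * t)
    (hβ : AEMeasurable β (volume.restrict (Ioi (0 : ℝ))))
    (hb : ∀ᵐ t ∂(volume.restrict (Ioi (0 : ℝ))), |β t| ≤ b) :
    IntegrableOn (costIntegrand g z β) (Ioi 0) := by
  have hC0 : 0 ≤ C := by have := (abs_nonneg _).trans (hgC 0); simpa using this
  have hint : IntegrableOn (fun t : ℝ => (C * (1 + |y|) + b ^ 2 / 2 + 2 * (C * V)) *
      Real.exp (-(1 / 2) * t)) (Ioi 0) :=
    (exp_neg_integrableOn_Ioi 0 (by norm_num : (0 : ℝ) < 1 / 2)).const_mul _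
  refine Integrable.mono' hint ?_ ?_
  · refine AEStronglyMeasurable.mul
      (Real.continuous_exp.comp continuous_neg).aestronglyMeasurable ?_
    refine AEStronglyMeasurable.add ?_ ((hβ.pow_const 2).div_const 2).aestronglyMeasurable
    exact (hg.comp_continuousOn hz).aestronglyMeasurable measurableSet_Ioi
  · filter_upwards [hb, ae_restrict_mem measurableSet_Ioi] with t hbt ht
    have ht0 : 0 ≤ t := le_of_lt ht
    refine le_trans ?_ (exp_neg_mul_le (mul_nonneg hC0 hV0) (by positivity) ht0)
    rw [costIntegrand, Real.norm_eq_abs, abs_mul, abs_of_pos (Real.exp_pos _)]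
    refine mul_le_mul_of_nonneg_left ?_ (Real.exp_pos _).le
    have h1 := hgC (z t)
    have h2 := mul_le_mul_of_nonneg_left (hzV t ht0) hC0
    have h3 : |β t ^ 2 / 2| ≤ b ^ 2 / 2 := by
      rw [abs_of_nonneg (by positivity)]
      have := sq_le_sq' (abs_le.1 hbt).1 (abs_le.1 hbt).2
      linarith
    have h4 := abs_add_le (g (z t)) (β t ^ 2 / 2)
    linarith

namespace IsClassicalSol

variable {h u p : Fin 2 → ℝ → ℝ} {M : ℝ} {i j : Fin 2} {B : Set ℝ} {y : ℝ} {β z : ℝ → ℝ}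

theorem equation_of_ne (S : IsClassicalSol h u p M) (hij : i ≠ j) (x : ℝ) :
    u i x = h i x - p i x * p j x - p i x ^ 2 / 2 := by
  have := S.equation i x
  fin_cases i <;> fin_cases j
  · exact absurd rfl hij
  · exact this
  · rw [mul_comm]; exact this
  · exact absurd rfl hij

/-- The speed of the trajectories is bounded. -/
theorem exists_speed (S : IsClassicalSol h u p M) (hB : IsCompact B)
    (P : IsControlPair B (fun x => -p j x) y β z) :
    ∃ b V, 0 ≤ V ∧ (∀ᵐ t ∂(volume.restrict (Ioi (0 : ℝ))), |β t| ≤ b) ∧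
      ∀ᵐ t ∂(volume.restrict (Ioi (0 : ℝ))), |β t + -p j (z t)| ≤ V := by
  obtain ⟨b, hb⟩ := hB.isBounded.exists_norm_le
  have h1 : ∀ᵐ t ∂(volume.restrict (Ioi (0 : ℝ))), |β t| ≤ b := P.mem.mono fun t ht => hb _ ht
  refine ⟨b, |b| + M, add_nonneg (abs_nonneg _) S.nonneg, h1, h1.mono fun t ht => ?_⟩
  refine (abs_add_le _ _).trans (add_le_add (ht.trans (le_abs_self _)) ?_)
  rw [abs_neg]
  exact S.bound _ _

theorem integrableOn (S : IsClassicalSol h u p M) (hc : ∀ i, Continuous (h i)) {C : ℝ}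
    (hC : ∀ i x, |h i x| ≤ C * (1 + |x|)) (hB : IsCompact B)
    (P : IsControlPair B (fun x => -p j x) y β z) :
    IntegrableOn (costIntegrand (h i) z β) (Ioi 0) := by
  obtain ⟨b, V, hV0, hb, hV⟩ := S.exists_speed hB P
  exact integrableOn_costIntegrand (hc i) (hC i) hV0 P.trajectory.continuousOn
    (fun t ht => P.trajectory.abs_le hV ht) P.measurable hb

/-- Verification: along a trajectory the running cost exceeds the decrease of the discounted value
function by a square. -/
theorem tendsto_integral (S : IsClassicalSol h u p M) (hc : ∀ i, Continuous (h i)) {C : ℝ}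
    (hC : ∀ i x, |h i x| ≤ C * (1 + |x|)) (hB : IsCompact B) (hij : i ≠ j)
    (P : IsControlPair B (fun x => -p j x) y β z) :
    Tendsto (fun T : ℝ => ∫ t in (0 : ℝ)..T, Real.exp (-t) * ((p i (z t) + β t) ^ 2 / 2)) atTop
      (𝓝 (cost (h i) z β - u i y)) := by
  obtain ⟨b, V, hV0, hb, hV⟩ := S.exists_speed hB P
  have Z := P.trajectory
  obtain ⟨D, hD⟩ := S.growth
  have hD0 : 0 ≤ D := by have := (abs_nonneg _).trans (hD 0 0); simpa using this
  set W : ℝ → ℝ := fun t => Real.exp (-t) * u i (z t) with hW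
  have hWlim : Tendsto W atTop (𝓝 0) := by
    refine squeeze_zero_norm' ?_ (tendsto_exp_half_atTop (D * (1 + |y|) + 2 * (D * V)))
    filter_upwards [eventually_ge_atTop 0] with t ht
    refine le_trans ?_ (exp_neg_mul_le (mul_nonneg hD0 hV0) (by positivity) ht)
    rw [Real.norm_eq_abs, abs_mul, abs_of_pos (Real.exp_pos _)]
    refine mul_le_mul_of_nonneg_left ?_ (Real.exp_pos _).le
    have h2 := mul_le_mul_of_nonneg_left (Z.abs_le hV ht) hD0
    linarith [hD i (z t)]
  -- Bounded speed makes the trajectory Lipschitz, so `u i ∘ z` is Lipschitz and `W` can be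
  -- recovered from its derivative.
  have hWac : ∀ T, 0 ≤ T → AbsolutelyContinuousOnInterval W 0 T := by
    intro T hT
    have hsub : uIcc 0 T ⊆ Ici 0 := by
      rw [uIcc_of_le hT]; exact Icc_subset_Ici_self
    refine AbsolutelyContinuousOnInterval.mul ?_ ?_
    · exact ((Real.contDiff_exp.comp contDiff_neg).contDiffOn).absolutelyContinuousOnInterval
    · exact (((S.lipschitzWith i).comp_lipschitzOnWith
        (Z.lipschitzOnWith hV0 hV)).mono hsub).absolutelyContinuousOnInterval
  have hint := S.integrableOn (i := i) hc hC hB P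
  have hlim : Tendsto (fun T : ℝ => (∫ t in (0 : ℝ)..T, costIntegrand (h i) z β t) + (W T - W 0))
      atTop (𝓝 (cost (h i) z β + (0 - W 0))) :=
    (intervalIntegral_tendsto_integral_Ioi 0 hint tendsto_id).add (hWlim.sub_const _)
  have hW0 : W 0 = u i y := by simp [hW, Z.initial]
  rw [zero_sub, hW0, ← sub_eq_add_neg] at hlim
  refine hlim.congr' ?_
  filter_upwards [eventually_ge_atTop 0] with T hT
  rw [← hW0, ← (hWac T hT).integral_deriv_eq_sub, ← intervalIntegral.integral_add]
  · refine intervalIntegral.integral_congr_ae ?_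
    filter_upwards [Z.ae_hasDerivAt] with t ht htT
    rw [uIoc_of_le hT] at htT
    have hz := ht htT.1
    have hd : HasDerivAt W (Real.exp (-t) * (-1) * u i (z t) +
        Real.exp (-t) * (p i (z t) * (β t + -p j (z t)))) t :=
      ((hasDerivAt_neg t).exp).mul ((S.hasDerivAt i (z t)).comp t hz)
    rw [hd.deriv, costIntegrand, S.equation_of_ne hij]
    ring
  · rw [intervalIntegrable_iff_integrableOn_Ioc_of_le hT]
    exact hint.mono_set Ioc_subset_Ioi_self
  · exact (hWac T hT).intervalIntegrable_deriv

theorem value_le_cost (S : IsClassicalSol h u p M) (hc : ∀ i, Continuous (h i)) {C : ℝ}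
    (hC : ∀ i x, |h i x| ≤ C * (1 + |x|)) (hB : IsCompact B) (hij : i ≠ j)
    (P : IsControlPair B (fun x => -p j x) y β z) : u i y ≤ cost (h i) z β := by
  refine sub_nonneg.1 (ge_of_tendsto (S.tendsto_integral hc hC hB hij P) ?_)
  filter_upwards [eventually_ge_atTop 0] with T hT
  exact intervalIntegral.integral_nonneg hT fun t _ => by positivity

theorem cost_eq_value (S : IsClassicalSol h u p M) (hc : ∀ i, Continuous (h i)) {C : ℝ}
    (hC : ∀ i x, |h i x| ≤ C * (1 + |x|)) (hB : IsCompact B) (hij : i ≠ j)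
    (P : IsControlPair B (fun x => -p j x) y (fun t => -p i (z t)) z) :
    cost (h i) z (fun t => -p i (z t)) = u i y := by
  have := S.tendsto_integral hc hC hB hij P
  simp only [add_neg_cancel, ne_eq, OfNat.ofNat_ne_zero, not_false_eq_true, zero_pow, zero_div,
    mul_zero, intervalIntegral.integral_zero] at this
  exact sub_eq_zero.1 (tendsto_nhds_unique this tendsto_const_nhds)

theorem exists_trajectory (S : IsClassicalSol h u p M) (y : ℝ) :
    ∃ z, IsCaratheodorySol (fun _ x => -p 0 x + -p 1 x) y z := by
  obtain ⟨K, hK⟩ := S.lipschitz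
  have hL : LipschitzWith (K + K) fun x => -p 0 x + -p 1 x := (hK 0).neg.add (hK 1).neg
  have hM : ∀ x, ‖-p 0 x + -p 1 x‖ ≤ ((Real.toNNReal M + Real.toNNReal M : NNReal) : ℝ) :=
    fun x => by
      rw [NNReal.coe_add, Real.coe_toNNReal _ S.nonneg]
      refine (norm_add_le _ _).trans (add_le_add ?_ ?_) <;> rw [norm_neg] <;> exact S.bound _ x
  obtain ⟨z, hz0, hz⟩ := exists_forall_hasDerivAt (f := fun _ x => -p 0 x + -p 1 x)
    (fun _ => hL) (fun _ => continuous_const) (fun _ => hM) 0 y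
  refine ⟨z, hz0, fun T _ => ?_, Eventually.of_forall fun t => hz t⟩
  refine ((lipschitzWith_of_nnnorm_deriv_le (𝕜 := ℝ)
    (C := Real.toNNReal M + Real.toNNReal M) (fun x => (hz x).differentiableAt)
    fun x => ?_).lipschitzOnWith).absolutelyContinuousOnInterval
  rw [(hz x).deriv, ← NNReal.coe_le_coe, coe_nnnorm]
  exact hM _

theorem isFeedbackNash (S : IsClassicalSol h u p M) (hc : ∀ i, Continuous (h i)) {C : ℝ}
    (hC : ∀ i x, |h i x| ≤ C * (1 + |x|)) {A : Fin 2 → Set ℝ} (hA : ∀ i, IsCompact (A i))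
    (hpA : ∀ i y, -p i y ∈ A i) : IsFeedbackNash A h fun i y => -p i y where
  mem := hpA
  exists_sol := S.exists_trajectory
  optimal y z Z i j hij := by
    have P : IsControlPair (A i) (fun x => -p j x) y (fun t => -p i (z t)) z := by
      refine ⟨?_, Eventually.of_forall fun t => hpA i _, Z.initial, Z.absolutelyContinuous,
        Z.equation.mono fun t ht => ?_⟩
      · exact ((S.continuous_gradient i).neg.comp_continuousOn Z.continuousOn).aemeasurable
          measurableSet_Ioi
      · refine ht.congr_deriv ?_
        fin_cases i <;> fin_cases j
        · exact absurd rfl hij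
        · rfl
        · exact add_comm _ _
        · exact absurd rfl hij
    refine ⟨P, fun β' z' P' => S.integrableOn hc hC (hA i) P', fun β' z' P' => ?_⟩
    rw [S.cost_eq_value hc hC (hA i) hij P]
    exact S.value_le_cost hc hC (hA i) hij P'

end IsClassicalSol

end ScalarGame

end

theorem mainTheorem1 (N : ℕ) (x : Fin N → ℝ) (κ : Fin (N + 1) → Fin 2 → ℝ)
    (h : Fin 2 → ℝ → ℝ) (hh : ScalarGame.IsPiecewiseLinear x κ h)
    (hκ : ∀ j i, 0 < κ j i) :
    (∃! u : Fin 2 → ℝ → ℝ, ScalarGame.IsAdmissible h u) ∧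
    ∀ u : Fin 2 → ℝ → ℝ, ScalarGame.IsAdmissible h u →
      (∀ i, Differentiable ℝ (u i)) ∧
      (∀ i, Bornology.IsBounded (Set.range (deriv (u i)))) ∧
      ∀ A : Fin 2 → Set ℝ, (∀ i, IsCompact (A i)) → (∀ i y, -deriv (u i) y ∈ A i) →
        ScalarGame.IsFeedbackNash A h (fun i y => -deriv (u i) y) := by
  obtain ⟨l, r, c, K, x₀, k, H⟩ := hh.exists_hasSlopes hκ
  obtain ⟨w, p, M, S⟩ := H.exists_isClassicalSol
  obtain ⟨C, hC⟩ := H.growth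
  refine ⟨⟨w, S.isAdmissible, fun u hu => ScalarGame.IsAdmissible.unique H hu S.isAdmissible⟩,
    fun u hu => ?_⟩
  -- Uniqueness transfers the regularity of the constructed solution to every admissible one.
  obtain rfl : u = w := ScalarGame.IsAdmissible.unique H hu S.isAdmissible
  refine ⟨fun i x => (S.hasDerivAt i x).differentiableAt, fun i => ?_, fun A hA hpA => ?_⟩
  · rw [S.deriv_eq]
    refine isBounded_iff_forall_norm_le.2 ⟨M, ?_⟩
    rintro _ ⟨x, rfl⟩
    exact S.bound i x
  · simp only [S.deriv_eq] at hpA ⊢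
    exact S.isFeedbackNash hh.continuous hC hA hpA
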